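/- Fix a universal prefix machine $U(p,y)$ (program $p$, auxiliary string $y$) with a step count: for each $y$ the halting programs form a prefix code, and every partial recursive $V(p,y)$ with this property is simulated by $U$ with a constant overhead in program length. Let $K(z\mid y)$ be the length of a shortest $p$ with $U(p,y)=z$, and $K(z)=K(z\mid\epsilon)$. Numbers are written in binary; tuples of strings are encoded by a fixed computable code, and a finite set of strings by the tuple of its elements in lexicographic order. Let $z^*$ be the shortest program for $z$ (ties: the fastest, then the lexicographically first). All logarithms are binary. A model of a string $x$ is a finite set $S\ni x$ of strings. Let $h_x(\alpha)=\min\{\lceil\log|S|\rceil : x\in S,\ K(S)\le\alpha\}$, and let $\alpha_0=\alpha_0(x)$ be the least $\alpha$ for which it is defined. The witness of $h_x(\alpha)$ is the model $S\ni x$ with $\log|S|\le h_x(\alpha)$ that is output by the first program of length $\alpha$ to halt with such an output. For a model $S$ of $x$, write $r_y$ for the number of elements of $S$ that precede $y$ lexicographically; the first $i$ bits of index of $y\in S$ are the first $i$ binary digits of $r_y/|S|$ after the point, and $S[i]$ is the set of $y\in S$ with the same first $i$ bits of index as $x$. Fix a constant $c\in\mathbb N$, let $\bar\imath(\gamma)=\max\{i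 : i+K(i)+c\le\gamma\}$ ($0$ if there is no such $i$), and $S(\gamma)=S[\bar\imath(\gamma)]$. Fix thresholds $Q_x(\alpha)\ge 0$ with $Q_x(\alpha)=K(h_x(\alpha)\mid\alpha)+O(\log\log |x|)$, for all $x$ and all $\alpha\ge\alpha_0(x)$. Put $k_{\alpha_0}=\alpha_0$, and for $\alpha>\alpha_0$ put $k_\alpha=\alpha$ if $k_{\alpha-1}+h_x(k_{\alpha-1})-\alpha-h_x(\alpha)\ge Q_x(k_{\alpha-1})$ and $k_\alpha=k_{\alpha-1}$ otherwise. Let $S^{(\alpha)}$ be the witness of $h_x(\alpha)$ if $k_\alpha=\alpha$ and $S^{(k_\alpha)}(\alpha-k_\alpha)$ otherwise, and let $\tilde h_x(\alpha)=\log|S^{(\alpha)}|$. Let $\alpha_1<\alpha_2<\dots<\alpha_M$ be the distinct values of $k_\alpha$, $\alpha\ge\alpha_0$, let $S_i=S^{(\alpha_i)}$, and for $2\le i\le M$ let $d_i=\tilde h_x(\alpha_i-1)-\tilde h_x(\alpha_i)$. Finally let $\delta(x\mid S)=\log|S|-K(x\mid S)$ and $\delta(x\mid S^*)=\log|S|-K(x\mid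 S^*)$, and let $\log^*m$ be the number of times the binary logarithm can be iterated from $m$ with a positive result. Theorem. There is a constant $C$, depending only on $U$, $c$ and $Q$, such that for all strings $x$, with $n=|x|$, and all $2\le i\le M$ (where $M$, $\alpha_i$, $S_i$, $d_i$ are those of $x$) the following holds. Write $$E_i = K(\alpha_i,\lceil\log|S_i|\rceil\mid x^*)-K(\alpha_{i-1},\lceil\log|S_{i-1}|\rceil\mid x^*)-K(\alpha_i-\alpha_{i-1}).$$ (a) If $n\ge2$, then $\bigl|\delta(x\mid S_{i-1})-\delta(x\mid S_i)-d_i\bigr|\le C\log n$. (b) $\bigl|\delta(x\mid S_{i-1}^*)-\delta(x\mid S_i^*)-d_i-E_i\bigr|\le C\,\bigl(1+\log^*(\alpha_i-\alpha_{i-1})\bigr)$. (c) If $n\ge2$, then $|E_i|\le C\log n$. -/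

import Mathlib

/-! ### Machines with a step count -/

/-- A deterministic machine with two inputs, a program `p` and an auxiliary string `y`.
Configurations are coded by natural numbers; `step` either moves to a new configuration or halts
with an output string.  Both the start configuration and the step are computable. -/
structure Machine where
  init : List Bool → List Bool → ℕ
  step : ℕ → ℕ ⊕ List Bool
  init_computable : Computable₂ init
  step_computable : Computable step

/-- The output reached from configuration `c` within `t` steps, if the machine halts by then. -/
def Machine.runFrom (U : Machine) : ℕ → ℕ → Option (List Bool)
  | 0, _ => none
  | t + 1, c =>
    match U.step c with
    | Sum.inl c' => U.runFrom t c'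
    | Sum.inr z => some z

/-- The output of `U(p, y)` within `t` steps. -/
def Machine.run (U : Machine) (t : ℕ) (p y : List Bool) : Option (List Bool) :=
  U.runFrom t (U.init p y)

/-- `U(p, y) = z`. -/
def Machine.Computes (U : Machine) (p y z : List Bool) : Prop :=
  ∃ t, U.run t p y = some z

/-- `U(p, y)` halts. -/
def Machine.Halts (U : Machine) (p y : List Bool) : Prop :=
  ∃ z, U.Computes p y z

/-- The running time of `U(p)` (without auxiliary input), in steps. -/
noncomputable def Machine.runTime (U : Machine) (p : List Bool) : ℕ :=
  sInf {t | ∃ z, U.run t p [] = some z}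

/-- The halting programs form a prefix code, for every auxiliary input, and every partial
recursive `V` with this property is simulated with a constant overhead in program length. -/
structure Machine.IsUniversalPrefix (U : Machine) : Prop where
  prefixFree : ∀ y p q : List Bool, U.Halts p y → U.Halts q y → p <+: q → p = q
  universal : ∀ V : List Bool → List Bool →. List Bool, Partrec₂ V →
    (∀ y p q : List Bool, (V p y).Dom → (V q y).Dom → p <+: q → p = q) →
    ∃ c : ℕ, ∀ p y z : List Bool, z ∈ V p y → ∃ p' : List Bool,
      p'.length ≤ p.length + c ∧ U.Computes p' y z

/-! ### Encodings -/

/-- The encoding `⟨x₁, …, x_N⟩` of a list of strings: each bit `b` of each string is written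
`1b`, and each string is closed by `0`. -/
def encList (l : List (List Bool)) : List Bool :=
  l.flatMap fun x => x.flatMap (fun b => [true, b]) ++ [false]

/-- The encoding of a finite set of strings: its elements in lexicographic order. -/
noncomputable def encSet (S : Finset (List Bool)) : List Bool :=
  encList (S.sort (· ≤ ·))

/-- The encoding of a pair of natural numbers (written in binary). -/
def encPair (a b : ℕ) : List Bool :=
  encList [Nat.bits a, Nat.bits b]

/-! ### Prefix complexity and shortest programs -/

/-- `K(z | y)`. -/
noncomputable def Machine.condK (U : Machine) (z y : List Bool) : ℕ :=
  sInf {n | ∃ p : List Bool, p.length = n ∧ U.Computes p y z}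

/-- `K(z)`. -/
noncomputable def Machine.K (U : Machine) (z : List Bool) : ℕ :=
  U.condK z []

/-- `K(m)` for a natural number `m`. -/
noncomputable def Machine.natK (U : Machine) (m : ℕ) : ℕ :=
  U.K (Nat.bits m)

/-- `K(S)` for a finite set of strings `S`. -/
noncomputable def Machine.setK (U : Machine) (S : Finset (List Bool)) : ℕ :=
  U.K (encSet S)

/-- The program in `P` that halts first, ties being broken lexicographically. -/
noncomputable def Machine.firstToHalt (U : Machine) (P : Set (List Bool)) : List Bool :=
  Classical.epsilon fun p => p ∈ P ∧
    ∀ q ∈ P, toLex (U.runTime p, p) ≤ toLex (U.runTime q, q)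

theorem Machine.firstToHalt_spec (U : Machine) (P : Set (List Bool)) (n : ℕ)
    (hP : ∀ p ∈ P, p.length = n) (hne : P.Nonempty) :
    U.firstToHalt P ∈ P ∧
      ∀ q ∈ P, toLex (U.runTime (U.firstToHalt P), U.firstToHalt P) ≤ toLex (U.runTime q, q) := by
  have hfin : P.Finite := (List.finite_length_eq Bool n).subset hP
  obtain ⟨p, hp, hmin⟩ := Set.exists_min_image P (fun p => toLex (U.runTime p, p)) hfin hne
  exact Classical.epsilon_spec
    (p := fun p => p ∈ P ∧ ∀ q ∈ P, toLex (U.runTime p, p) ≤ toLex (U.runTime q, q))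
    ⟨p, hp, hmin⟩

/-- `z*`: the shortest program for `z`; among several, the fastest; among several of these, the
lexicographically first. -/
noncomputable def Machine.shortest (U : Machine) (z : List Bool) : List Bool :=
  U.firstToHalt {p | p.length = U.K z ∧ U.Computes p [] z}

/-- `S*` for a finite set of strings `S`. -/
noncomputable def Machine.setShortest (U : Machine) (S : Finset (List Bool)) : List Bool :=
  U.shortest (encSet S)

/-! ### The structure function -/

/-- `h_x(α)`, the least `⌈log |S|⌉` over the models `S ∋ x` with `K(S) ≤ α`. -/
noncomputable def Machine.structFun (U : Machine) (x : List Bool) (α : ℕ) : ℕ :=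
  sInf {m | ∃ S : Finset (List Bool), x ∈ S ∧ U.setK S ≤ α ∧ Nat.clog 2 S.card = m}

/-- `α₀`, the least `α` for which `h_x(α)` is defined. -/
noncomputable def Machine.minLevel (U : Machine) (x : List Bool) : ℕ :=
  sInf {α | ∃ S : Finset (List Bool), x ∈ S ∧ U.setK S ≤ α}

/-- The witness of `h_x(α)`: the set produced by the first program of length `α` to halt with a
model `S` of `x` such that `log |S| ≤ h_x(α)`. -/
noncomputable def Machine.witness (U : Machine) (x : List Bool) (α : ℕ) : Finset (List Bool) :=
  Classical.epsilon fun S => U.Computes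
    (U.firstToHalt {p | p.length = α ∧ ∃ S : Finset (List Bool),
      x ∈ S ∧ Nat.clog 2 S.card ≤ U.structFun x α ∧ U.Computes p [] (encSet S)})
    [] (encSet S)

/-! ### Index models -/

/-- The number of elements of `S` that precede `y` lexicographically. -/
noncomputable def rankIn (S : Finset (List Bool)) (y : List Bool) : ℕ :=
  (S.filter fun w => w < y).card

/-- The index model `S[i]`: the elements of `S` with the same first `i` bits of index as `x`.
The bits of index of `y ∈ S` are the binary digits of `rankIn S y / |S|` (the first `i` of them
are given by the integer part of `2 ^ i * rankIn S y / |S|`), so that each bit halves the set; if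
`|S| = 2 ^ L`, they are the `L` binary digits of `rankIn S y`. -/
noncomputable def indexModel (S : Finset (List Bool)) (x : List Bool) (i : ℕ) :
    Finset (List Bool) :=
  S.filter fun y => 2 ^ i * rankIn S y / S.card = 2 ^ i * rankIn S x / S.card

/-- `ī(γ)`, the largest `i` with `i + K(i) + c ≤ γ` (and `0` if there is none). -/
noncomputable def Machine.indexBits (U : Machine) (c γ : ℕ) : ℕ :=
  sSup {i | i + U.natK i + c ≤ γ}

/-! ### The modified structure function -/

/-- `k_α`, the level of the last drop at or before `α`, for `α ≥ α₀` and threshold `Q`. -/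
noncomputable def Machine.lastDrop (U : Machine) (Q : ℕ → ℝ) (x : List Bool) : ℕ → ℕ
  | 0 => U.minLevel x
  | α + 1 =>
    if α + 1 ≤ U.minLevel x then U.minLevel x
    else if Q (U.lastDrop Q x α) ≤
        ((U.lastDrop Q x α : ℝ) + (U.structFun x (U.lastDrop Q x α) : ℝ))
          - ((α + 1 : ℕ) : ℝ) - (U.structFun x (α + 1) : ℝ)
      then α + 1
      else U.lastDrop Q x α

/-- `S^(α)`: the witness of `h_x(α)` if there is a drop at `α`, and otherwise the model obtained
from the witness at the last drop by spending the remaining `α - k_α` bits on index bits. -/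
noncomputable def Machine.modelAt (U : Machine) (c : ℕ) (Q : ℕ → ℝ) (x : List Bool) (α : ℕ) :
    Finset (List Bool) :=
  if U.lastDrop Q x α = α then U.witness x α
  else indexModel (U.witness x (U.lastDrop Q x α)) x (U.indexBits c (α - U.lastDrop Q x α))

/-- The modified structure function `h̃_x(α) = log |S^(α)|`. -/
noncomputable def Machine.modStructFun (U : Machine) (c : ℕ) (Q : ℕ → ℝ) (x : List Bool)
    (α : ℕ) : ℝ :=
  Real.logb 2 ((U.modelAt c Q x α).card : ℝ)

/-- `a` is one of the numbers `k_α`, `α ≥ α₀`. -/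
def Machine.IsDropLevel (U : Machine) (Q : ℕ → ℝ) (x : List Bool) (a : ℕ) : Prop :=
  ∃ α, U.minLevel x ≤ α ∧ U.lastDrop Q x α = a

/-- The number `M` of minimal partial models. -/
noncomputable def Machine.numModels (U : Machine) (Q : ℕ → ℝ) (x : List Bool) : ℕ∞ :=
  Set.encard {a | U.IsDropLevel Q x a}

/-- `α_i`, the `i`-th drop level in increasing order, for `1 ≤ i ≤ M`. -/
noncomputable def Machine.level (U : Machine) (Q : ℕ → ℝ) (x : List Bool) (i : ℕ) : ℕ :=
  Nat.nth (U.IsDropLevel Q x) (i - 1)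

/-- The `i`-th minimal partial model `S_i`, for `1 ≤ i ≤ M`. -/
noncomputable def Machine.partialModel (U : Machine) (c : ℕ) (Q : ℕ → ℝ) (x : List Bool)
    (i : ℕ) : Finset (List Bool) :=
  U.modelAt c Q x (U.level Q x i)

/-- The height `d_i = h̃_x(α_i - 1) - h̃_x(α_i)` of the `i`-th drop, for `2 ≤ i ≤ M`. -/
noncomputable def Machine.drop (U : Machine) (c : ℕ) (Q : ℕ → ℝ) (x : List Bool) (i : ℕ) : ℝ :=
  U.modStructFun c Q x (U.level Q x i - 1) - U.modStructFun c Q x (U.level Q x i)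

/-! ### Randomness deficiency -/

/-- `δ(x | S) = log |S| - K(x | S)`. -/
noncomputable def Machine.deficiency (U : Machine) (x : List Bool) (S : Finset (List Bool)) : ℝ :=
  Real.logb 2 (S.card : ℝ) - (U.condK x (encSet S) : ℝ)

/-- `δ(x | S*) = log |S| - K(x | S*)`. -/
noncomputable def Machine.strongDeficiency (U : Machine) (x : List Bool)
    (S : Finset (List Bool)) : ℝ :=
  Real.logb 2 (S.card : ℝ) - (U.condK x (U.setShortest S) : ℝ)

/-- `K(α_i, ⌈log |S_i|⌉ | x*)`. -/
noncomputable def Machine.advice (U : Machine) (c : ℕ) (Q : ℕ → ℝ) (x : List Bool) (i : ℕ) : ℕ :=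
  U.condK (encPair (U.level Q x i) (Nat.clog 2 (U.partialModel c Q x i).card)) (U.shortest x)

/-- `log* m`: how many times the binary logarithm can be iterated from `m` with a positive
result, that is, the least `k` such that the `(k + 1)`-st iterate is not positive. -/
noncomputable def logStar (m : ℕ) : ℕ :=
  sInf {k | (Real.logb 2)^[k + 1] (m : ℝ) ≤ 0}

/-!
# Randomness deficiencies of minimal partial models

The complexity `K(· | ·)` is only used through a few inequalities with constant error.  Upper bounds
come from two machines: one reads a self-delimiting code (`exists_condK_le_length`), the other runs
two programs in a row, the second with an auxiliary input computed from the first one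
(`exists_condK_le_add`).  The lower bound is the hard half of the symmetry of information,
`K(x) + K(y | x*) ≤ K(x, y) + O(1)` (`exists_K_add_condK_le`).  It follows from the Kraft–Chaitin
theorem (`kraft_chaitin`), used once to prove the coding theorem (`exists_sum_lengthFor_le`: the
programs for pairs starting with `x` have total weight `O(2 ^ (-K(x)))`) and once more, given `x*`,
for the codewords of length `|q| - K(x) + O(1)` for `y`, where `q` runs over the programs for pairs
`⟨x, y⟩`.

Let `a` be a drop level and `S` the witness at `a`.  The structure function strictly decreases at a
drop, so `K(S) = a` and `⌈log |S|⌉ = h_x(a)` (`witness_spec`).  By the symmetry of information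
`K(x | S*) = K(x) + K(S | x*) - a + O(1)`.  Here `K(S | x*) = K(a, ⌈log |S|⌉ | x*) + O(1)`: on one
hand `x`, `a` and `⌈log |S|⌉` determine the first program of length `a` to halt with such a model;
on the other hand `S*` determines `a = |S*|` and `|S|`, and given `x*` it is not more complex than
`S` (`exists_condK_shortest_shortest_le`), again by the symmetry of information.  This gives
`δ(x | S*)` up to a constant (`exists_abs_strongDeficiency_sub_le`).

If `a < b` are consecutive drop levels, then `h̃_x(b - 1)` is the log-size of an index model with
`b - a - K(b - a) + O(1)` bits of index (`exists_abs_indexBits_sub_le`), and these bits halve the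
witness at `a` because `b - a ≤ h_x(a)`; so the height of the drop at `b` is known up to a constant
(`exists_abs_drop_sub_le`).  Together these facts determine the change of `δ(x | S*)`
up to a constant.

To bound `E_i`, the levels are bounded first.  The set of all strings of length `n` is a model at
some level `β = O(log n)`.  A drop level `k < β` may have an enormous `h_x(k)`, but if the next drop lies
beyond `β`, the threshold at `β` was missed, which by the bound on `Q` gives
`k + h_x(k) < β + n + O(log h_x(k) + log log n)` and so `h_x(k) = O(n)`.  As `k + h_x(k)` does not
increase from one drop level to the next, all drop levels are `O(n)` (`exists_level_le`).  A witness
at a level up to `β` has complexity `O(log n)`, and beyond `β` its log-size is at most `n`, so the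
terms of `E_i` are `O(log n)` in either case (`exists_condK_level_le`).

The estimate for `δ(x | S)` follows from those for `δ(x | S*)` and `E_i`, because `S*` can be found
from `S` and the number `K(S)`, so that the two deficiencies differ by `O(log n)`
(`exists_condK_le_condK_shortest`, `exists_abs_deficiency_sub_le`).
-/

namespace Machine

/-! ### Running a machine is computable -/

/-- One step of a machine on states, where a state is a configuration or a final output. -/
def next (U : Machine) (s : ℕ ⊕ List Bool) : ℕ ⊕ List Bool :=
  s.elim U.step Sum.inr

theorem next_iterate_inr (U : Machine) (t : ℕ) (z : List Bool) :
    U.next^[t] (Sum.inr z) = Sum.inr z :=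
  Function.iterate_fixed rfl t

theorem runFrom_eq (U : Machine) (t c : ℕ) :
    U.runFrom t c = (U.next^[t] (Sum.inl c)).getRight? := by
  induction t generalizing c with
  | zero => rfl
  | succ t ih =>
    rw [Function.iterate_succ_apply]
    change (match U.step c with
      | Sum.inl c' => U.runFrom t c'
      | Sum.inr z => some z) = (U.next^[t] (U.step c)).getRight?
    rcases h : U.step c with c' | z
    · simpa using ih c'
    · simp [next_iterate_inr]

theorem next_computable (U : Machine) : Computable U.next := by
  have h : Computable fun s : ℕ ⊕ List Bool =>
      (Sum.casesOn s (fun c => U.step c) (fun z => Sum.inr z) : ℕ ⊕ List Bool) :=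
    Computable.sumCasesOn Computable.id (U.step_computable.comp Computable.snd).to₂
      (Computable.sumInr.comp Computable.snd).to₂
  exact h.of_eq fun s => by cases s <;> rfl

theorem run_computable (U : Machine) :
    Computable fun a : ℕ × List Bool × List Bool => U.run a.1 a.2.1 a.2.2 := by
  have h1 : Computable fun a : ℕ × List Bool × List Bool =>
      (Nat.rec (Sum.inl (U.init a.2.1 a.2.2)) (fun _ s => U.next s) a.1 : ℕ ⊕ List Bool) :=
    Computable.nat_rec (h := fun _ q => U.next q.2) Computable.fst
      (Computable.sumInl.comp (U.init_computable.comp (Computable.fst.comp Computable.snd)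
        (Computable.snd.comp Computable.snd)))
      (U.next_computable.comp (Computable.snd.comp Computable.snd)).to₂
  have h2 : Computable fun s : ℕ ⊕ List Bool =>
      (Sum.casesOn s (fun _ => none) (fun z => some z) : Option (List Bool)) :=
    Computable.sumCasesOn Computable.id (Computable.const _).to₂
      (Computable.option_some.comp Computable.snd).to₂
  refine (h2.comp h1).of_eq fun a => ?_
  rw [Machine.run, runFrom_eq]
  have h3 : ∀ t, U.next^[t] (Sum.inl (U.init a.2.1 a.2.2)) =
      (Nat.rec (Sum.inl (U.init a.2.1 a.2.2)) (fun _ s => U.next s) t : ℕ ⊕ List Bool) := by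
    intro t
    induction t with
    | zero => rfl
    | succ t ih => rw [Function.iterate_succ_apply', ih]
  rw [h3]
  generalize (Nat.rec (Sum.inl (U.init a.2.1 a.2.2)) (fun _ s => U.next s) a.1 :
    ℕ ⊕ List Bool) = s
  cases s <;> rfl

theorem computable_run {α : Type*} [Primcodable α] (U : Machine) {t : α → ℕ}
    {p y : α → List Bool} (ht : Computable t) (hp : Computable p) (hy : Computable y) :
    Computable fun a => U.run (t a) (p a) (y a) := by
  have h := U.run_computable.comp (ht.pair (hp.pair hy))
  exact h

theorem run_mono (U : Machine) {s t : ℕ} {p y z : List Bool} (hst : s ≤ t)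
    (h : U.run s p y = some z) : U.run t p y = some z := by
  rw [Machine.run, runFrom_eq] at h ⊢
  obtain ⟨k, rfl⟩ := Nat.exists_eq_add_of_le' hst
  rw [Sum.getRight?_eq_some_iff] at h
  rw [Function.iterate_add_apply, h, next_iterate_inr]
  rfl

theorem Computes.unique {U : Machine} {p y z w : List Bool} (hz : U.Computes p y z)
    (hw : U.Computes p y w) : z = w := by
  obtain ⟨s, hs⟩ := hz
  obtain ⟨t, ht⟩ := hw
  have h1 := U.run_mono (le_max_left s t) hs
  have h2 := U.run_mono (le_max_right s t) ht
  exact Option.some.inj (h1.symm.trans h2)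

/-- `U(p, y)` as a partial function. -/
def eval (U : Machine) (p y : List Bool) : Part (List Bool) :=
  Nat.rfindOpt fun t => U.run t p y

theorem mem_eval {U : Machine} {p y z : List Bool} : z ∈ U.eval p y ↔ U.Computes p y z := by
  rw [eval, Nat.rfindOpt_mono]
  · rfl
  · intro a m n hmn h
    exact U.run_mono hmn h

theorem eval_partrec (U : Machine) : Partrec₂ U.eval := by
  refine Partrec.rfindOpt (f := fun (a : List Bool × List Bool) t => U.run t a.1 a.2) ?_
  exact (U.computable_run Computable.snd (Computable.fst.comp Computable.fst)
    (Computable.snd.comp Computable.fst)).to₂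

/-! ### Programs and complexity -/

theorem condK_le_of_computes {U : Machine} {p y z : List Bool} (h : U.Computes p y z) :
    U.condK z y ≤ p.length :=
  Nat.sInf_le ⟨p, rfl, h⟩

namespace IsUniversalPrefix

variable {U : Machine}

theorem exists_condK_le (hU : U.IsUniversalPrefix) (V : List Bool → List Bool →. List Bool)
    (hV : Partrec₂ V)
    (hpre : ∀ y p q : List Bool, (V p y).Dom → (V q y).Dom → p <+: q → p = q) :
    ∃ c : ℕ, ∀ p y z : List Bool, z ∈ V p y →
      U.condK z y ≤ p.length + c ∧ ∃ q, U.Computes q y z := by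
  obtain ⟨c, hc⟩ := hU.universal V hV hpre
  refine ⟨c, fun p y z h => ?_⟩
  obtain ⟨p', hl, hp'⟩ := hc p y z h
  exact ⟨(condK_le_of_computes hp').trans hl, p', hp'⟩

end IsUniversalPrefix

end Machine

/-! ### Self-delimiting codes -/

theorem encList_nil : encList [] = [] := rfl

theorem encList_cons (x : List Bool) (l : List (List Bool)) :
    encList (x :: l) = x.flatMap (fun b => [true, b]) ++ false :: encList l := by
  simp [encList]

theorem length_encList_singleton (z : List Bool) :
    (encList [z]).length = 2 * z.length + 1 := by
  have : (z.flatMap fun b => [true, b]).length = 2 * z.length := by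
    induction z with
    | nil => rfl
    | cons b z ih => simp [ih]; omega
  simp [encList, this]

/-- The first string can be read off from a code. -/
theorem encList_cons_inj {x y : List Bool} {u v : List Bool}
    (h : x.flatMap (fun b => [true, b]) ++ false :: u =
      y.flatMap (fun b => [true, b]) ++ false :: v) : x = y ∧ u = v := by
  induction x generalizing y with
  | nil =>
    cases y with
    | nil => simpa using h
    | cons b y => simp at h
  | cons a x ih =>
    cases y with
    | nil => simp at h
    | cons b y =>
      simp only [List.flatMap_cons, List.cons_append, List.nil_append, List.cons.injEq,
        true_and] at h
      obtain ⟨h1, h2⟩ := ih h.2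
      exact ⟨by rw [h.1, h1], h2⟩

theorem encList_injective : Function.Injective encList := by
  intro l m h
  induction l generalizing m with
  | nil =>
    cases m with
    | nil => rfl
    | cons y m => simp [encList] at h
  | cons x l ih =>
    cases m with
    | nil => simp [encList] at h
    | cons y m =>
      rw [encList_cons, encList_cons] at h
      obtain ⟨h1, h2⟩ := encList_cons_inj h
      rw [h1, ih h2]

theorem encList_singleton_prefix {x y : List Bool} (h : encList [x] <+: encList [y]) : x = y := by
  obtain ⟨t, ht⟩ := h
  rw [encList_cons, encList_cons, encList_nil, List.append_assoc] at ht
  exact (encList_cons_inj ht).1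

theorem encSet_injective : Function.Injective encSet := by
  intro S T h
  have := encList_injective h
  rw [← Finset.sort_toFinset (s := S) (r := (· ≤ ·)), this, Finset.sort_toFinset]

theorem encList_primrec : Primrec encList := by
  refine Primrec.list_flatMap Primrec.id ?_
  refine Primrec₂.comp Primrec.list_append ?_ (Primrec.const _)
  refine Primrec.list_flatMap Primrec.snd ?_
  exact Primrec.list_cons.comp (Primrec.const _)
    (Primrec.list_cons.comp Primrec.snd (Primrec.const _))

/-- The state of the decoder of `encList`: whether the next bit is a data bit, the bits of the
current string, and the strings completed so far. -/
def decStep (s : Bool × List Bool × List (List Bool)) (b : Bool) :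
    Bool × List Bool × List (List Bool) :=
  if s.1 then (false, s.2.1 ++ [b], s.2.2)
  else if b then (true, s.2.1, s.2.2)
  else (false, [], s.2.2 ++ [s.2.1])

/-- A left inverse of `encList`. -/
def decList (z : List Bool) : List (List Bool) :=
  (z.foldl decStep (false, [], [])).2.2

theorem foldl_decStep_flatMap (x u cur : List Bool) (acc : List (List Bool)) :
    (x.flatMap (fun b => [true, b]) ++ false :: u).foldl decStep (false, cur, acc) =
      u.foldl decStep (false, [], acc ++ [cur ++ x]) := by
  induction x generalizing cur with
  | nil => simp [decStep]
  | cons b x ih => simpa [decStep] using ih (cur ++ [b])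

theorem decList_encList (l : List (List Bool)) : decList (encList l) = l := by
  have : ∀ acc, ((encList l).foldl decStep (false, [], acc)).2.2 = acc ++ l := by
    induction l with
    | nil => intro acc; simp [encList_nil]
    | cons x l ih => intro acc; rw [encList_cons, foldl_decStep_flatMap, ih]; simp
  exact this []

theorem decStep_primrec : Primrec₂ decStep := by
  have hs : Primrec fun a : (Bool × List Bool × List (List Bool)) × Bool => a.1.1 :=
    Primrec.fst.comp Primrec.fst
  have hc : Primrec fun a : (Bool × List Bool × List (List Bool)) × Bool => a.1.2.1 :=
    Primrec.fst.comp (Primrec.snd.comp Primrec.fst)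
  have ha : Primrec fun a : (Bool × List Bool × List (List Bool)) × Bool => a.1.2.2 :=
    Primrec.snd.comp (Primrec.snd.comp Primrec.fst)
  refine Primrec.ite (Primrec.eq.comp hs (Primrec.const true)) ?_
    (Primrec.ite (Primrec.eq.comp Primrec.snd (Primrec.const true)) ?_ ?_)
  · exact (Primrec.const false).pair ((Primrec.list_concat.comp hc Primrec.snd).pair ha)
  · exact (Primrec.const true).pair (hc.pair ha)
  · exact (Primrec.const false).pair ((Primrec.const []).pair (Primrec.list_concat.comp ha hc))

theorem decList_primrec : Primrec decList :=
  Primrec.snd.comp (Primrec.snd.comp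
    (Primrec.list_foldl Primrec.id (Primrec.const _) (decStep_primrec.comp
      (Primrec.fst.comp Primrec.snd) (Primrec.snd.comp Primrec.snd)).to₂))

namespace Machine

variable {U : Machine}

namespace IsUniversalPrefix

/-- The program `encList [z]`, which spells out its output, has length `2 |z| + 1`. -/
theorem exists_condK_le_length (hU : U.IsUniversalPrefix) :
    ∃ c : ℕ, ∀ z y : List Bool, U.condK z y ≤ 2 * z.length + c ∧ ∃ q, U.Computes q y z := by
  let V : List Bool → List Bool →. List Bool := fun p _ =>
    (if encList [(decList p).headI] = p then some (decList p).headI else none :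
      Option (List Bool))
  have hV : Partrec₂ V := by
    refine Computable.ofOption (Primrec.to_comp ?_)
    have h : Primrec fun a : List Bool × List Bool => (decList a.1).headI :=
      Primrec.list_headI.comp (decList_primrec.comp Primrec.fst)
    exact Primrec.ite (Primrec.eq.comp (encList_primrec.comp (Primrec.list_cons.comp h
      (Primrec.const []))) Primrec.fst) (Primrec.option_some.comp h) (Primrec.const none)
  have hdom : ∀ p y, (V p y).Dom → ∃ x, p = encList [x] := by
    intro p y h
    by_cases hp : encList [(decList p).headI] = p
    · exact ⟨_, hp.symm⟩
    · simp [V, hp] at h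
  obtain ⟨c, hc⟩ := hU.exists_condK_le V hV (by
    intro y p q hp hq hpq
    obtain ⟨a, rfl⟩ := hdom p y hp
    obtain ⟨b, rfl⟩ := hdom q y hq
    rw [encList_singleton_prefix hpq])
  refine ⟨1 + c, fun z y => ?_⟩
  have := hc (encList [z]) y z (by simp [V, decList_encList])
  rw [length_encList_singleton] at this
  exact ⟨by omega, this.2⟩

theorem exists_program (hU : U.IsUniversalPrefix) (z y : List Bool) :
    ∃ p, p.length = U.condK z y ∧ U.Computes p y z := by
  obtain ⟨c, hc⟩ := hU.exists_condK_le_length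
  obtain ⟨q, hq⟩ := (hc z y).2
  exact Nat.sInf_mem (s := {n | ∃ p : List Bool, p.length = n ∧ U.Computes p y z})
    ⟨_, q, rfl, hq⟩

theorem shortest_spec (hU : U.IsUniversalPrefix) (z : List Bool) :
    (U.shortest z).length = U.K z ∧ U.Computes (U.shortest z) [] z := by
  obtain ⟨p, hp⟩ := hU.exists_program z []
  exact (U.firstToHalt_spec {p | p.length = U.K z ∧ U.Computes p [] z} (U.K z)
    (fun p hp => hp.1) ⟨p, hp⟩).1

end IsUniversalPrefix

/-! ### Concatenating programs -/

/-- The decomposition of `r` into a program `p` that halts on `y` and a remainder `q`, together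
with the output of `p`. -/
def split (U : Machine) (r y : List Bool) : Part (List Bool × List Bool × List Bool) :=
  Nat.rfindOpt fun n => (U.run n.unpair.2 (r.take n.unpair.1) y).map fun z =>
    (r.take n.unpair.1, r.drop n.unpair.1, z)

theorem split_partrec (U : Machine) : Partrec₂ U.split := by
  have hi : Computable fun a : (List Bool × List Bool) × ℕ => a.2.unpair.1 :=
    Computable.fst.comp (Computable.unpair.comp Computable.snd)
  have ht : Computable fun a : (List Bool × List Bool) × ℕ => a.2.unpair.2 :=
    Computable.snd.comp (Computable.unpair.comp Computable.snd)
  have hr : Computable fun a : (List Bool × List Bool) × ℕ => a.1.1 :=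
    Computable.fst.comp Computable.fst
  have hta : Computable fun a : (List Bool × List Bool) × ℕ => a.1.1.take a.2.unpair.1 :=
    Computable₂.comp Primrec.list_take.to_comp hi hr
  have hdr : Computable fun a : (List Bool × List Bool) × ℕ => a.1.1.drop a.2.unpair.1 :=
    Computable₂.comp Primrec.list_drop.to_comp hi hr
  have hrun : Computable fun a : (List Bool × List Bool) × ℕ =>
      U.run a.2.unpair.2 (a.1.1.take a.2.unpair.1) a.1.2 :=
    U.computable_run ht hta (Computable.snd.comp Computable.fst)
  have hout : Computable₂ fun (a : (List Bool × List Bool) × ℕ) (z : List Bool) =>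
      (a.1.1.take a.2.unpair.1, a.1.1.drop a.2.unpair.1, z) :=
    Computable.pair (hta.comp Computable.fst)
      (Computable.pair (hdr.comp Computable.fst) Computable.snd)
  have h : Computable₂ fun (a : List Bool × List Bool) (n : ℕ) =>
      (U.run n.unpair.2 (a.1.take n.unpair.1) a.2).map fun z =>
        (a.1.take n.unpair.1, a.1.drop n.unpair.1, z) :=
    (Computable.option_map hrun hout).to₂
  have h2 := Partrec.rfindOpt h
  exact h2

theorem of_mem_split {r y p q z : List Bool} (h : (p, q, z) ∈ U.split r y) :
    r = p ++ q ∧ U.Computes p y z := by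
  obtain ⟨n, hn⟩ := Nat.rfindOpt_spec h
  obtain ⟨z', hz', he⟩ := Option.map_eq_some_iff.1 hn
  simp only [Prod.mk.injEq] at he
  obtain ⟨rfl, rfl, rfl⟩ := he
  exact ⟨(List.take_append_drop _ _).symm, _, hz'⟩

theorem IsUniversalPrefix.mem_split (hU : U.IsUniversalPrefix) {y p q z : List Bool}
    (h : U.Computes p y z) : (p, q, z) ∈ U.split (p ++ q) y := by
  obtain ⟨t, ht⟩ := h
  have hd : (U.split (p ++ q) y).Dom := by
    rw [split, Nat.rfindOpt_dom]
    refine ⟨Nat.pair p.length t, (p, q, z), ?_⟩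
    simp [ht]
  obtain ⟨⟨p', q', z'⟩, hm⟩ := Part.dom_iff_mem.1 hd
  obtain ⟨he, hc⟩ := of_mem_split hm
  have hp : p = p' := by
    rcases List.prefix_or_prefix_of_prefix (List.prefix_append p q) (he ▸ List.prefix_append p' q')
      with h | h
    · exact hU.prefixFree y _ _ ⟨z, t, ht⟩ ⟨z', hc⟩ h
    · exact (hU.prefixFree y _ _ ⟨z', hc⟩ ⟨z, t, ht⟩ h).symm
  subst hp
  obtain rfl := List.append_cancel_left he
  obtain rfl := Computes.unique ⟨t, ht⟩ hc
  exact hm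

/-- Two programs in a row: the second one runs with auxiliary input computed from the first
program, its output and the auxiliary input, and everything may be used for the final output. -/
theorem IsUniversalPrefix.exists_condK_le_add (hU : U.IsUniversalPrefix)
    {f : List Bool × List Bool × List Bool →. List Bool} (hf : Partrec f)
    {g : List Bool × List Bool × List Bool × List Bool →. List Bool} (hg : Partrec g) :
    ∃ c : ℕ, ∀ p y z y' q w v : List Bool, U.Computes p y z → y' ∈ f (p, z, y) →
      U.Computes q y' w → v ∈ g (p, z, w, y) → U.condK v y ≤ p.length + q.length + c := by
  let V : List Bool → List Bool →. List Bool := fun r y =>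
    (U.split r y).bind fun s => (f (s.1, s.2.2, y)).bind fun y' =>
      (U.eval s.2.1 y').bind fun w => g (s.1, s.2.2, w, y)
  have hV : Partrec₂ V := by
    refine Partrec.bind U.split_partrec ?_
    have hp : Computable fun a : (List Bool × List Bool) × List Bool × List Bool × List Bool =>
        a.2.1 := Computable.fst.comp Computable.snd
    have hz : Computable fun a : (List Bool × List Bool) × List Bool × List Bool × List Bool =>
        a.2.2.2 := Computable.snd.comp (Computable.snd.comp Computable.snd)
    have hq : Computable fun a : (List Bool × List Bool) × List Bool × List Bool × List Bool =>
        a.2.2.1 := Computable.fst.comp (Computable.snd.comp Computable.snd)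
    have hy : Computable fun a : (List Bool × List Bool) × List Bool × List Bool × List Bool =>
        a.1.2 := Computable.snd.comp Computable.fst
    refine Partrec.bind (hf.comp (hp.pair (hz.pair hy))) ?_
    refine Partrec.bind (U.eval_partrec.comp (hq.comp Computable.fst) Computable.snd) ?_
    exact hg.comp ((hp.comp (Computable.fst.comp Computable.fst)).pair
      ((hz.comp (Computable.fst.comp Computable.fst)).pair (Computable.snd.pair
        (hy.comp (Computable.fst.comp Computable.fst)))))
  have hmem : ∀ r y v, v ∈ V r y → ∃ p q z y' w, r = p ++ q ∧ U.Computes p y z ∧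
      y' ∈ f (p, z, y) ∧ U.Computes q y' w := by
    intro r y v h
    simp only [V, Part.mem_bind_iff] at h
    obtain ⟨⟨p, q, z⟩, h1, y', h2, w, h3, -⟩ := h
    obtain ⟨h4, h5⟩ := of_mem_split h1
    exact ⟨p, q, z, y', w, h4, h5, h2, mem_eval.1 h3⟩
  obtain ⟨c, hc⟩ := hU.exists_condK_le V hV (by
    intro y r r' hr hr' hrr
    obtain ⟨v, hv⟩ := Part.dom_iff_mem.1 hr
    obtain ⟨v', hv'⟩ := Part.dom_iff_mem.1 hr'
    obtain ⟨p, q, z, u, w, rfl, h1, h2, h3⟩ := hmem _ _ _ hv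
    obtain ⟨p', q', z', u', w', rfl, h1', h2', h3'⟩ := hmem _ _ _ hv'
    have hp : p = p' := by
      rcases List.prefix_or_prefix_of_prefix ((List.prefix_append p q).trans hrr)
        (List.prefix_append p' q') with h | h
      · exact hU.prefixFree y _ _ ⟨z, h1⟩ ⟨z', h1'⟩ h
      · exact (hU.prefixFree y _ _ ⟨z', h1'⟩ ⟨z, h1⟩ h).symm
    subst hp
    obtain rfl := Computes.unique h1 h1'
    obtain rfl := Part.mem_unique h2 h2'
    rw [hU.prefixFree _ _ _ ⟨w, h3⟩ ⟨w', h3'⟩ ((List.prefix_append_right_inj p).1 hrr)])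
  refine ⟨c, fun p y z y' q w v h1 h2 h3 h4 => ?_⟩
  have := (hc (p ++ q) y v ?_).1
  · rwa [List.length_append] at this
  · simp only [V, Part.mem_bind_iff]
    exact ⟨(p, q, z), hU.mem_split h1, y', h2, w, mem_eval.2 h3, h4⟩

namespace IsUniversalPrefix

/-- Post-processing: the final output may depend on a program, its output and the auxiliary
input. -/
theorem exists_condK_map_le (hU : U.IsUniversalPrefix)
    {g : List Bool × List Bool × List Bool →. List Bool} (hg : Partrec g) :
    ∃ c : ℕ, ∀ p y z v : List Bool, U.Computes p y z → v ∈ g (p, z, y) →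
      U.condK v y ≤ p.length + c := by
  obtain ⟨q, -, hq⟩ := hU.exists_program [] []
  obtain ⟨c, hc⟩ := hU.exists_condK_le_add (f := fun _ => Part.some []) (Computable.const [])
    (g := fun a => g (a.1, a.2.1, a.2.2.2)) (hg.comp (Computable.fst.pair
      ((Computable.fst.comp Computable.snd).pair
        (Computable.snd.comp (Computable.snd.comp Computable.snd)))))
  refine ⟨q.length + c, fun p y z v h1 h2 => ?_⟩
  have := hc p y z [] q [] v h1 (Part.mem_some _) hq h2
  omega

/-- Changing the auxiliary input. -/
theorem exists_condK_le_of_mem (hU : U.IsUniversalPrefix)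
    {f : List Bool →. List Bool} (hf : Partrec f) :
    ∃ c : ℕ, ∀ y y' z : List Bool, y' ∈ f y → U.condK z y ≤ U.condK z y' + c := by
  obtain ⟨c, hc⟩ := hU.exists_condK_le_add (f := fun a => f a.2.2)
    (hf.comp (Computable.snd.comp Computable.snd))
    (g := fun a => Part.some a.2.2.1)
    (Computable.fst.comp (Computable.snd.comp Computable.snd))
  obtain ⟨d, hd⟩ := hU.exists_condK_le_length
  refine ⟨c + d, fun y y' z h => ?_⟩
  obtain ⟨p, hpl, hp⟩ := hU.exists_program [] y
  obtain ⟨q, hql, hq⟩ := hU.exists_program z y'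
  have h1 := hc p y [] y' q z z hp h hq (Part.mem_some _)
  have h2 := (hd [] y).1
  simp only [List.length_nil] at h2
  omega

end IsUniversalPrefix

end Machine

/-! ### Binary words of a given length -/

/-- The `k` lowest binary digits of `m`, most significant digit first. -/
def bitsBE : ℕ → ℕ → List Bool
  | 0, _ => []
  | k + 1, m => bitsBE k (m / 2) ++ [decide (m % 2 = 1)]

/-- The number with the given binary digits, most significant digit first. -/
def valBE (z : List Bool) : ℕ :=
  z.foldl (fun n b => 2 * n + b.toNat) 0

@[simp]
theorem length_bitsBE (k m : ℕ) : (bitsBE k m).length = k := by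
  induction k generalizing m with
  | zero => rfl
  | succ k ih => simp [bitsBE, ih]

theorem valBE_concat (z : List Bool) (b : Bool) : valBE (z ++ [b]) = 2 * valBE z + b.toNat := by
  simp [valBE]

theorem valBE_append (z w : List Bool) : valBE (z ++ w) = valBE z * 2 ^ w.length + valBE w := by
  induction w using List.reverseRecOn with
  | nil => simp [valBE]
  | append_singleton w b ih =>
    rw [← List.append_assoc, valBE_concat, ih, valBE_concat, List.length_append]
    simp only [List.length_singleton, pow_succ]
    ring

theorem valBE_lt (z : List Bool) : valBE z < 2 ^ z.length := by
  induction z using List.reverseRecOn with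
  | nil => simp [valBE]
  | append_singleton z b ih =>
    rw [valBE_concat, List.length_append, List.length_singleton, pow_succ]
    have := Bool.toNat_le b
    omega

theorem valBE_bitsBE {k m : ℕ} (h : m < 2 ^ k) : valBE (bitsBE k m) = m := by
  induction k generalizing m with
  | zero =>
    have : m = 0 := by simpa using h
    simp [bitsBE, valBE, this]
  | succ k ih =>
    rw [bitsBE, valBE_concat, ih (by rw [pow_succ] at h; omega)]
    rcases Nat.mod_two_eq_zero_or_one m with h | h <;> simp [h] <;> omega

theorem bitsBE_valBE (z : List Bool) : bitsBE z.length (valBE z) = z := by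
  induction z using List.reverseRecOn with
  | nil => rfl
  | append_singleton z b ih =>
    rw [List.length_append, List.length_singleton, bitsBE, valBE_concat]
    have hb := Bool.toNat_le b
    have h1 : (2 * valBE z + b.toNat) / 2 = valBE z := by omega
    have h2 : decide ((2 * valBE z + b.toNat) % 2 = 1) = b := by
      cases b <;> simp
    rw [h1, h2, ih]

theorem bitsBE_primrec : Primrec₂ bitsBE := by
  let f : ℕ × List Bool → ℕ × List Bool := fun s => (s.1 / 2, decide (s.1 % 2 = 1) :: s.2)
  have hf : Primrec f := by
    have h1 : Primrec fun s : ℕ × List Bool => s.1 / 2 :=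
      Primrec.nat_div.comp Primrec.fst (Primrec.const 2)
    have h2 : Primrec fun s : ℕ × List Bool => decide (s.1 % 2 = 1) :=
      (Primrec.eq.comp (Primrec.nat_mod.comp Primrec.fst (Primrec.const 2))
        (Primrec.const 1)).decide
    exact h1.pair (Primrec.list_cons.comp h2 Primrec.snd)
  have h : ∀ k m acc, (f^[k] (m, acc)).2 = bitsBE k m ++ acc := by
    intro k
    induction k with
    | zero => intro m acc; rfl
    | succ k ih => intro m acc; rw [Function.iterate_succ_apply, ih]; simp [bitsBE]
  have h2 : Primrec fun a : ℕ × ℕ => (f^[a.1] (a.2, [])).2 :=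
    Primrec.snd.comp (Primrec.nat_iterate Primrec.fst (Primrec.snd.pair (Primrec.const []))
      (hf.comp Primrec.snd).to₂)
  exact h2.of_eq fun a => by rw [h, List.append_nil]

theorem nat_pow_primrec : Primrec₂ ((· ^ ·) : ℕ → ℕ → ℕ) :=
  Primrec₂.unpaired'.1 Nat.Primrec.pow

/-! ### Sums of powers of two -/

/-- The weight `2 ^ (-l)` of a codeword of length `l`, and `0` if there is no codeword. -/
noncomputable def weight : Option ℕ → ℝ
  | none => 0
  | some l => (1 / 2) ^ l

theorem weight_nonneg (o : Option ℕ) : 0 ≤ weight o := by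
  cases o <;> simp [weight]

/-- The sum of the weights of the first `n` lengths, as a numerator and the binary logarithm of a
denominator. -/
def dyadicSum (R : ℕ → Option ℕ) : ℕ → ℕ × ℕ
  | 0 => (0, 0)
  | n + 1 => (R n).elim (dyadicSum R n) fun l =>
      ((dyadicSum R n).1 * 2 ^ l + 2 ^ (dyadicSum R n).2, (dyadicSum R n).2 + l)

theorem dyadicSum_eq (R : ℕ → Option ℕ) (n : ℕ) :
    ((dyadicSum R n).1 : ℝ) / 2 ^ (dyadicSum R n).2 = ∑ j ∈ Finset.range n, weight (R j) := by
  induction n with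
  | zero => simp [dyadicSum]
  | succ n ih =>
    rw [Finset.sum_range_succ, ← ih, dyadicSum]
    cases R n with
    | none => simp [weight]
    | some l =>
      simp only [Option.elim, weight, pow_add, Nat.cast_add, Nat.cast_mul, Nat.cast_pow,
        Nat.cast_ofNat, one_div, inv_pow]
      field_simp

theorem dyadicSum_computable {α : Type*} [Primcodable α] {R : α → ℕ → Option ℕ}
    (hR : Computable₂ R) : Computable₂ fun a n => dyadicSum (R a) n := by
  have hs : Computable fun b : ((α × ℕ) × ℕ × ℕ × ℕ) × ℕ => b.1.2.2 :=
    Computable.snd.comp (Computable.snd.comp Computable.fst)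
  have hpow : Computable₂ ((· ^ ·) : ℕ → ℕ → ℕ) := nat_pow_primrec.to_comp
  have hadd : Computable₂ ((· + ·) : ℕ → ℕ → ℕ) := Primrec.nat_add.to_comp
  have hmul : Computable₂ ((· * ·) : ℕ → ℕ → ℕ) := Primrec.nat_mul.to_comp
  have hnew : Computable₂ fun (b : (α × ℕ) × ℕ × ℕ × ℕ) (l : ℕ) =>
      (b.2.2.1 * 2 ^ l + 2 ^ b.2.2.2, b.2.2.2 + l) :=
    Computable.pair
      (hadd.comp (hmul.comp (Computable.fst.comp hs) (hpow.comp (Computable.const 2)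
        Computable.snd)) (hpow.comp (Computable.const 2) (Computable.snd.comp hs)))
      (hadd.comp (Computable.snd.comp hs) Computable.snd)
  have hstep : Computable₂ fun (b : α × ℕ) (q : ℕ × ℕ × ℕ) =>
      (Option.casesOn (R b.1 q.1) q.2 fun l => (q.2.1 * 2 ^ l + 2 ^ q.2.2, q.2.2 + l) :
        ℕ × ℕ) :=
    Computable.option_casesOn
      (hR.comp (Computable.fst.comp Computable.fst) (Computable.fst.comp Computable.snd))
      (Computable.snd.comp Computable.snd) hnew
  have h := Computable.nat_rec (f := fun b : α × ℕ => b.2) (g := fun _ => ((0, 0) : ℕ × ℕ))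
    Computable.snd (Computable.const _) hstep
  refine h.of_eq fun b => ?_
  obtain ⟨a, n⟩ := b
  induction n with
  | zero => rfl
  | succ n ih =>
    simp only [dyadicSum] at ih ⊢
    rw [← ih]
    cases R a n <;> rfl

/-! ### Prefix codes with prescribed lengths -/

/-- The codeword of length `l + 1` for the interval of length `2 ^ (-l)` starting at `N / 2 ^ L`:
it names a dyadic interval of half the length inside that interval. -/
def codeword (l : ℕ) (s : ℕ × ℕ) : List Bool :=
  bitsBE (l + 1) ((s.1 * 2 ^ (l + 1) + 2 ^ s.2 - 1) / 2 ^ s.2)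

theorem codeword_primrec : Primrec₂ codeword := by
  have hl : Primrec fun a : ℕ × ℕ × ℕ => a.1 + 1 := Primrec.succ.comp Primrec.fst
  have hpow : ∀ {f : ℕ × ℕ × ℕ → ℕ}, Primrec f → Primrec fun a => 2 ^ f a :=
    fun hf => nat_pow_primrec.comp (Primrec.const 2) hf
  have h1 : Primrec fun a : ℕ × ℕ × ℕ => a.2.1 := Primrec.fst.comp Primrec.snd
  have h2 : Primrec fun a : ℕ × ℕ × ℕ => 2 ^ a.2.2 := hpow (Primrec.snd.comp Primrec.snd)
  exact bitsBE_primrec.comp hl (Primrec.nat_div.comp (Primrec.nat_sub.comp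
    (Primrec.nat_add.comp (Primrec.nat_mul.comp h1 (hpow hl)) h2) (Primrec.const 1)) h2)

/-- If the interval lies in the unit interval, then so does the dyadic interval named by the
codeword, and it lies in the given interval. -/
theorem codeword_bounds {l N L : ℕ} (h : (N : ℝ) / 2 ^ L + (1 / 2) ^ l ≤ 1) :
    (N : ℝ) / 2 ^ L ≤ (valBE (codeword l (N, L)) : ℝ) / 2 ^ (l + 1) ∧
      ((valBE (codeword l (N, L)) : ℝ) + 1) / 2 ^ (l + 1) ≤ (N : ℝ) / 2 ^ L + (1 / 2) ^ l := by
  set k := (N * 2 ^ (l + 1) + 2 ^ L - 1) / 2 ^ L with hk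
  have hL : 0 < 2 ^ L := by positivity
  have h1 : N * 2 ^ (l + 1) ≤ k * 2 ^ L := by
    have := Nat.lt_div_mul_add (a := N * 2 ^ (l + 1) + 2 ^ L - 1) hL
    rw [← hk] at this
    omega
  have h2' : k * 2 ^ L < N * 2 ^ (l + 1) + 2 ^ L := by
    have := Nat.div_mul_le_self (N * 2 ^ (l + 1) + 2 ^ L - 1) (2 ^ L)
    rw [← hk] at this
    omega
  have h1r : (N : ℝ) * 2 ^ (l + 1) ≤ k * 2 ^ L := by exact_mod_cast h1
  have h2r : (k : ℝ) * 2 ^ L < N * 2 ^ (l + 1) + 2 ^ L := by exact_mod_cast h2'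
  have hLr : (0 : ℝ) < 2 ^ L := by positivity
  have hlr : (0 : ℝ) < 2 ^ (l + 1) := by positivity
  have he : (N : ℝ) / 2 ^ L + (1 / 2) ^ l =
      (N * 2 ^ (l + 1) + 2 * 2 ^ L) / (2 ^ L * 2 ^ (l + 1)) := by
    rw [one_div, inv_pow, pow_succ]
    field_simp
  have hup : ((k : ℝ) + 1) / 2 ^ (l + 1) < (N : ℝ) / 2 ^ L + (1 / 2) ^ l := by
    rw [he, div_lt_div_iff₀ hlr (by positivity)]
    nlinarith
  have hk1 : k < 2 ^ (l + 1) := by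
    have h3 := hup.trans_le h
    rw [div_lt_one hlr] at h3
    have : (k : ℝ) < 2 ^ (l + 1) := by linarith
    exact_mod_cast this
  have hv : valBE (codeword l (N, L)) = k := valBE_bitsBE hk1
  rw [hv]
  refine ⟨?_, hup.le⟩
  rw [div_le_div_iff₀ hLr hlr]
  exact h1r

theorem valBE_div_of_prefix {p q : List Bool} (h : p <+: q) :
    (valBE p : ℝ) / 2 ^ p.length ≤ (valBE q : ℝ) / 2 ^ q.length ∧
      (valBE q : ℝ) / 2 ^ q.length < ((valBE p : ℝ) + 1) / 2 ^ p.length := by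
  obtain ⟨r, rfl⟩ := h
  have hr : (valBE r : ℝ) < 2 ^ r.length := by exact_mod_cast valBE_lt r
  have h0 : (0 : ℝ) ≤ valBE r := by positivity
  rw [valBE_append, List.length_append, pow_add]
  push_cast
  constructor
  · rw [div_le_div_iff₀ (by positivity) (by positivity)]
    nlinarith [pow_pos (two_pos : (0 : ℝ) < 2) p.length]
  · rw [div_lt_div_iff₀ (by positivity) (by positivity)]
    nlinarith [pow_pos (two_pos : (0 : ℝ) < 2) p.length]

namespace Machine

/-- The test whether the `n`-th request is answered by the codeword `r`.  Requests that would
push the total weight beyond `1` are not answered. -/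
def answers (R : List Bool → ℕ → Option (ℕ × List Bool)) (a : List Bool × List Bool) (n : ℕ) :
    Option (List Bool) :=
  (R a.2 n).bind fun q =>
    if codeword q.1 (dyadicSum (fun j => (R a.2 j).map Prod.fst) n) = a.1 ∧
      (dyadicSum (fun j => (R a.2 j).map Prod.fst) (n + 1)).1 ≤
        2 ^ (dyadicSum (fun j => (R a.2 j).map Prod.fst) (n + 1)).2
    then some q.2 else none

theorem answers_computable {R : List Bool → ℕ → Option (ℕ × List Bool)} (hR : Computable₂ R) :
    Computable₂ (answers R) := by
  have hlen : Computable₂ fun y n => (R y n).map Prod.fst :=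
    Computable.option_map hR (Computable.fst.comp Computable.snd).to₂
  have hsum := dyadicSum_computable hlen
  have hy : Computable fun a : ((List Bool × List Bool) × ℕ) × ℕ × List Bool => a.1.1.2 :=
    Computable.snd.comp (Computable.fst.comp Computable.fst)
  have hn : Computable fun a : ((List Bool × List Bool) × ℕ) × ℕ × List Bool => a.1.2 :=
    Computable.snd.comp Computable.fst
  have hs := hsum.comp hy hn
  have hs' := hsum.comp hy (Computable.succ.comp hn)
  have hcode : Computable fun a : ((List Bool × List Bool) × ℕ) × ℕ × List Bool =>
      codeword a.2.1 (dyadicSum (fun j => (R a.1.1.2 j).map Prod.fst) a.1.2) :=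
    Computable₂.comp codeword_primrec.to_comp (Computable.fst.comp Computable.snd) hs
  have hr : Computable fun a : ((List Bool × List Bool) × ℕ) × ℕ × List Bool => a.1.1.1 :=
    Computable.fst.comp (Computable.fst.comp Computable.fst)
  -- the final test and output are primitive recursive in these four data
  have htest : Primrec fun b : (List Bool × List Bool) × (ℕ × ℕ) × List Bool =>
      if b.1.1 = b.1.2 ∧ b.2.1.1 ≤ 2 ^ b.2.1.2 then some b.2.2 else none := by
    have h1 : Primrec fun b : (List Bool × List Bool) × (ℕ × ℕ) × List Bool => b.2.1 :=
      Primrec.fst.comp Primrec.snd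
    exact Primrec.ite (PrimrecPred.and
      (Primrec.eq.comp (Primrec.fst.comp Primrec.fst) (Primrec.snd.comp Primrec.fst))
      (Primrec.nat_le.comp (Primrec.fst.comp h1)
        (nat_pow_primrec.comp (Primrec.const 2) (Primrec.snd.comp h1))))
      (Primrec.option_some.comp (Primrec.snd.comp Primrec.snd)) (Primrec.const none)
  have h := htest.to_comp.comp
    ((hcode.pair hr).pair (hs'.pair (Computable.snd.comp Computable.snd)))
  have h2 : Computable fun a : (List Bool × List Bool) × ℕ => R a.1.2 a.2 :=
    hR.comp (Computable.snd.comp Computable.fst) Computable.snd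
  exact (Computable.option_bind h2 h.to₂)

theorem mem_answers {R : List Bool → ℕ → Option (ℕ × List Bool)} {r y z : List Bool} {n : ℕ} :
    answers R (r, y) n = some z ↔ ∃ l, R y n = some (l, z) ∧
      codeword l (dyadicSum (fun j => (R y j).map Prod.fst) n) = r ∧
      ∑ j ∈ Finset.range (n + 1), weight ((R y j).map Prod.fst) ≤ 1 := by
  rw [← dyadicSum_eq, div_le_one (by positivity), answers]
  simp only [Option.bind_eq_some_iff, Option.ite_none_right_eq_some, Option.some.injEq]
  norm_cast
  constructor
  · rintro ⟨⟨l, w⟩, h1, ⟨h2, h3⟩, rfl⟩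
    exact ⟨l, h1, h2, h3⟩
  · rintro ⟨l, h1, h2, h3⟩
    exact ⟨(l, z), h1, ⟨h2, h3⟩, rfl⟩

/-- Codewords of different requests are incomparable. -/
theorem answers_index_unique {R : List Bool → ℕ → Option (ℕ × List Bool)}
    {r r' y z z' : List Bool} {m n : ℕ} (hm : answers R (r, y) m = some z)
    (hn : answers R (r', y) n = some z') (hrr : r <+: r') : m = n := by
  set S : ℕ → ℝ := fun n => ∑ j ∈ Finset.range n, weight ((R y j).map Prod.fst) with hS
  have hmono : Monotone S := by
    refine monotone_nat_of_le_succ fun n => ?_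
    simp only [hS, Finset.sum_range_succ]
    linarith [weight_nonneg ((R y n).map Prod.fst)]
  have key : ∀ {r z n}, answers R (r, y) n = some z →
      S n ≤ (valBE r : ℝ) / 2 ^ r.length ∧ ((valBE r : ℝ) + 1) / 2 ^ r.length ≤ S (n + 1) := by
    intro r z n h
    obtain ⟨l, h1, rfl, h3⟩ := mem_answers.1 h
    have h4 : S (n + 1) = S n + (1 / 2) ^ l := by
      simp only [hS, Finset.sum_range_succ, h1]
      rfl
    have h5 : S n = _ := (dyadicSum_eq (fun j => (R y j).map Prod.fst) n).symm
    have h6 : (codeword l (dyadicSum (fun j => (R y j).map Prod.fst) n)).length = l + 1 :=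
      length_bitsBE _ _
    rw [h4, h6, h5]
    exact codeword_bounds (by rw [← h5, ← h4]; exact h3)
  obtain ⟨a1, a2⟩ := key hm
  obtain ⟨b1, b2⟩ := key hn
  obtain ⟨c1, c2⟩ := valBE_div_of_prefix hrr
  have hpos : (0 : ℝ) < 1 / 2 ^ r'.length := by positivity
  rw [add_div] at b2
  rcases lt_trichotomy m n with h | h | h
  · have := hmono (Nat.succ_le_of_lt h)
    simp only [Nat.succ_eq_add_one] at this
    linarith
  · exact h
  · have := hmono (Nat.succ_le_of_lt h)
    simp only [Nat.succ_eq_add_one] at this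
    linarith

/-- The Kraft–Chaitin theorem: if the requested lengths satisfy Kraft's inequality, then all
requests are met up to an additive constant. -/
theorem IsUniversalPrefix.kraft_chaitin {U : Machine} (hU : U.IsUniversalPrefix)
    {R : List Bool → ℕ → Option (ℕ × List Bool)} (hR : Computable₂ R) :
    ∃ c : ℕ, ∀ y : List Bool,
      (∀ n, ∑ j ∈ Finset.range n, weight ((R y j).map Prod.fst) ≤ 1) →
      ∀ n l z, R y n = some (l, z) → U.condK z y ≤ l + c := by
  obtain ⟨c, hc⟩ := hU.exists_condK_le (fun r y => Nat.rfindOpt (answers R (r, y)))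
    (Partrec.rfindOpt (answers_computable hR)) (by
      intro y r r' hr hr' hrr
      obtain ⟨m, z, hm⟩ := Nat.rfindOpt_dom.1 hr
      obtain ⟨n, z', hn⟩ := Nat.rfindOpt_dom.1 hr'
      obtain rfl := answers_index_unique hm hn hrr
      obtain ⟨l, h1, rfl, -⟩ := mem_answers.1 hm
      obtain ⟨l', h1', rfl, -⟩ := mem_answers.1 hn
      rw [h1] at h1'
      simp only [Option.some.injEq, Prod.mk.injEq] at h1'
      rw [h1'.1])
  refine ⟨c + 1, fun y hy n l z hn => ?_⟩
  have h1 : answers R (codeword l (dyadicSum (fun j => (R y j).map Prod.fst) n), y) n = some z :=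
    mem_answers.2 ⟨l, hn, rfl, hy _⟩
  obtain ⟨w, hw⟩ := Part.dom_iff_mem.1 (Nat.rfindOpt_dom.2 ⟨n, z, h1⟩)
  obtain ⟨m, hm⟩ := Nat.rfindOpt_spec hw
  obtain rfl := answers_index_unique hm h1 List.prefix_rfl
  obtain rfl : w = z := Option.some.inj (Eq.trans (Eq.symm hm) h1)
  have := (hc _ _ _ hw).1
  have h2 : (codeword l (dyadicSum (fun j => (R y j).map Prod.fst) m)).length = l + 1 :=
    length_bitsBE _ _
  omega

end Machine

/-! ### Kraft's inequality for prefix codes -/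

theorem kraft_inequality_of_prefixFree (S : Finset (List Bool))
    (h : ∀ p ∈ S, ∀ q ∈ S, p <+: q → p = q) :
    ∑ p ∈ S, ((1 : ℝ) / 2) ^ p.length ≤ 1 := by
  by_cases h0 : [] ∈ S
  · have hS : S = {[]} := by
      refine Finset.eq_singleton_iff_unique_mem.2 ⟨h0, fun q hq => ?_⟩
      exact (h [] h0 q hq List.nil_prefix).symm
    simp [hS]
  have hud : InformationTheory.UniquelyDecodable (S : Set (List Bool)) := by
    intro L
    induction L with
    | nil =>
      intro M _ hM he
      cases M with
      | nil => rfl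
      | cons q M =>
        simp only [List.flatten_nil, List.flatten_cons, List.nil_eq, List.append_eq_nil_iff] at he
        exact absurd (he.1 ▸ hM q (by simp)) h0
    | cons p L ih =>
      intro M hL hM he
      cases M with
      | nil =>
        simp only [List.flatten_nil, List.flatten_cons, List.append_eq_nil_iff] at he
        exact absurd (he.1 ▸ hL p (by simp)) h0
      | cons q M =>
        simp only [List.flatten_cons] at he
        have hp := hL p (by simp)
        have hq := hM q (by simp)
        have hpq : p = q := by
          rcases List.prefix_or_prefix_of_prefix (List.prefix_append p L.flatten)
            (he ▸ List.prefix_append q M.flatten) with h' | h'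
          · exact h p hp q hq h'
          · exact (h q hq p hp h').symm
        subst hpq
        rw [ih M (fun w hw => hL w (by simp [hw])) (fun w hw => hM w (by simp [hw]))
          (List.append_cancel_left he)]
  simpa using InformationTheory.kraft_mcmillan_inequality hud

namespace Machine

/-! ### Enumerating the halting programs -/

/-- An enumeration of the halting programs (without auxiliary input) and their outputs: the pair
`(e, t)` stands for the program number `e` if it halts in exactly `t + 1` steps, so that each
halting program occurs once. -/
def halting (U : Machine) (n : ℕ) : Option (List Bool × List Bool) :=
  (Encodable.decode (α := List Bool) n.unpair.1).bind fun p =>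
    if Encodable.encode p = n.unpair.1 ∧ U.run n.unpair.2 p [] = none then
      (U.run (n.unpair.2 + 1) p []).map fun z => (p, z)
    else none

theorem halting_computable (U : Machine) : Computable U.halting := by
  have hn : Computable fun a : ℕ × List Bool => a.1.unpair :=
    Computable.unpair.comp Computable.fst
  have ht : Computable fun a : ℕ × List Bool => a.1.unpair.2 := Computable.snd.comp hn
  have h1 := U.computable_run ht Computable.snd (Computable.const [])
  have h2 := U.computable_run (Computable.succ.comp ht) Computable.snd (Computable.const [])
  have hm : Computable fun a : ℕ × List Bool =>
      (U.run (a.1.unpair.2 + 1) a.2 []).map fun z => (a.2, z) :=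
    Computable.option_map h2 ((Computable.snd.comp Computable.fst).pair Computable.snd).to₂
  have hp : Primrec fun b : (ℕ × ℕ) × Option (List Bool) =>
      decide (b.1.1 = b.1.2 ∧ b.2 = none) :=
    (PrimrecPred.and (Primrec.eq.comp (Primrec.fst.comp Primrec.fst)
      (Primrec.snd.comp Primrec.fst)) (Primrec.eq.comp Primrec.snd (Primrec.const none))).decide
  have hc := hp.to_comp.comp
    (((Computable.encode.comp Computable.snd).pair (Computable.fst.comp hn)).pair h1)
  have h := Computable.option_bind (Computable.decode (α := List Bool) |>.comp
    (Computable.fst.comp Computable.unpair)) (Computable.cond hc hm (Computable.const none)).to₂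
  refine h.of_eq fun n => ?_
  simp only [halting, Bool.cond_decide]

theorem halting_eq_some {U : Machine} {n : ℕ} {p z : List Bool} :
    U.halting n = some (p, z) ↔ n.unpair.1 = Encodable.encode p ∧
      U.run n.unpair.2 p [] = none ∧ U.run (n.unpair.2 + 1) p [] = some z := by
  simp only [halting, Option.bind_eq_some_iff, Option.ite_none_right_eq_some,
    Option.map_eq_some_iff, Prod.mk.injEq]
  constructor
  · rintro ⟨p, h1, ⟨h2, h3⟩, z, h4, rfl, rfl⟩
    exact ⟨h2.symm, h3, h4⟩
  · rintro ⟨h1, h2, h3⟩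
    exact ⟨p, by rw [h1, Encodable.encodek], ⟨h1.symm, h2⟩, z, h3, rfl, rfl⟩

theorem computes_of_halting {U : Machine} {n : ℕ} {p z : List Bool}
    (h : U.halting n = some (p, z)) : U.Computes p [] z := by
  exact ⟨_, (halting_eq_some.1 h).2.2⟩

theorem exists_halting {U : Machine} {p z : List Bool} (h : U.Computes p [] z) :
    ∃ n, U.halting n = some (p, z) := by
  classical
  have h' : ∃ t, U.run t p [] = some z := h
  obtain ⟨t, ht⟩ : ∃ t, Nat.find h' = t + 1 := by
    refine Nat.exists_eq_succ_of_ne_zero fun h0 => ?_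
    have := Nat.find_spec h'
    rw [h0] at this
    cases this
  refine ⟨Nat.pair (Encodable.encode p) t, ?_⟩
  have h1 : U.run (t + 1) p [] = some z := ht ▸ Nat.find_spec h'
  have h2 : U.run t p [] = none := by
    by_contra hne
    obtain ⟨w, hw⟩ := Option.ne_none_iff_exists'.1 hne
    have h3 := U.run_mono (Nat.le_succ t) hw
    rw [Nat.succ_eq_add_one, h1] at h3
    rw [← Option.some.inj h3] at hw
    exact Nat.find_min h' (by omega) hw
  exact halting_eq_some.2 (by simpa using ⟨h2, h1⟩)

theorem halting_injective {U : Machine} {m n : ℕ} {p z w : List Bool}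
    (hm : U.halting m = some (p, z)) (hn : U.halting n = some (p, w)) : m = n := by
  obtain ⟨a1, a2, a3⟩ := halting_eq_some.1 hm
  obtain ⟨b1, b2, b3⟩ := halting_eq_some.1 hn
  have hne : ∀ {s t : ℕ} {z : List Bool}, U.run s p [] = none → U.run (t + 1) p [] = some z →
      s ≤ t := by
    intro s t z h1 h2
    by_contra hst
    rw [U.run_mono (show t + 1 ≤ s by omega) h2] at h1
    cases h1
  rw [← Nat.pair_unpair m, ← Nat.pair_unpair n, a1, b1, le_antisymm (hne a2 b3) (hne b2 a3)]

theorem IsUniversalPrefix.sum_halting_le_one {U : Machine} (hU : U.IsUniversalPrefix) (n : ℕ) :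
    ∑ j ∈ Finset.range n, weight ((U.halting j).map fun q => q.1.length) ≤ 1 := by
  classical
  set T := (Finset.range n).filter fun j => (U.halting j).isSome with hT
  let g : ℕ → List Bool := fun j => ((U.halting j).map Prod.fst).getD []
  have hg : ∀ j ∈ T, ∃ z, U.halting j = some (g j, z) := by
    intro j hj
    obtain ⟨⟨p, z⟩, hpz⟩ := Option.isSome_iff_exists.1 (Finset.mem_filter.1 hj).2
    exact ⟨z, by simp [g, hpz]⟩
  have hinj : Set.InjOn g T := by
    intro i hi j hj hij
    obtain ⟨z, hz⟩ := hg i hi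
    obtain ⟨w, hw⟩ := hg j hj
    exact halting_injective hz (hij ▸ hw)
  have h1 : ∑ j ∈ Finset.range n, weight ((U.halting j).map fun q => q.1.length) =
      ∑ j ∈ T, ((1 : ℝ) / 2) ^ (g j).length := by
    rw [hT, Finset.sum_filter]
    refine Finset.sum_congr rfl fun j _ => ?_
    rcases h : U.halting j with _ | ⟨p, z⟩ <;> simp [weight, g, h]
  rw [h1, ← Finset.sum_image (f := fun p : List Bool => ((1 : ℝ) / 2) ^ p.length) hinj]
  refine kraft_inequality_of_prefixFree _ fun p hp q hq hpq => ?_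
  obtain ⟨i, hi, rfl⟩ := Finset.mem_image.1 hp
  obtain ⟨j, hj, rfl⟩ := Finset.mem_image.1 hq
  obtain ⟨z, hz⟩ := hg i hi
  obtain ⟨w, hw⟩ := hg j hj
  exact hU.prefixFree [] _ _ ⟨z, computes_of_halting hz⟩ ⟨w, computes_of_halting hw⟩ hpq

/-! ### The coding theorem -/

/-- The length of the `n`-th halting program, if its output codes a tuple that starts with `x`. -/
def lengthFor (U : Machine) (x : List Bool) (n : ℕ) : Option ℕ :=
  (U.halting n).bind fun q => if (decList q.2).headI = x then some q.1.length else none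

theorem lengthFor_computable (U : Machine) : Computable₂ U.lengthFor := by
  have h : Primrec fun b : List Bool × List Bool × List Bool =>
      if (decList b.2.2).headI = b.1 then some b.2.1.length else none :=
    Primrec.ite (Primrec.eq.comp (Primrec.list_headI.comp (decList_primrec.comp
      (Primrec.snd.comp Primrec.snd))) Primrec.fst)
      (Primrec.option_some.comp (Primrec.list_length.comp (Primrec.fst.comp Primrec.snd)))
      (Primrec.const none)
  have h2 := h.to_comp.comp (α := (List Bool × ℕ) × List Bool × List Bool)
    ((Computable.fst.comp Computable.fst).pair Computable.snd)
  exact Computable.option_bind (U.halting_computable.comp Computable.snd) h2.to₂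

/-- The total weight of the programs for tuples starting with `x` among the first `n` halting
programs, as a numerator and the binary logarithm of a denominator. -/
def mass (U : Machine) (x : List Bool) (n : ℕ) : ℕ × ℕ :=
  dyadicSum (U.lengthFor x) n

/-- The `k` such that `2 ^ (-k)` is the largest power of two up to `N / 2 ^ L`, if
`0 < N / 2 ^ L ≤ 1`. -/
def dyadicExp (s : ℕ × ℕ) : ℕ :=
  s.2 - Nat.findGreatest (fun e => 2 ^ e ≤ s.1) s.1

theorem dyadicExp_primrec : Primrec dyadicExp := by
  have h : PrimrecRel fun (s : ℕ × ℕ) (e : ℕ) => 2 ^ e ≤ s.1 :=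
    Primrec.nat_le.comp (nat_pow_primrec.comp (Primrec.const 2) Primrec.snd)
      (Primrec.fst.comp Primrec.fst)
  exact Primrec.nat_sub.comp Primrec.snd (Primrec.nat_findGreatest Primrec.fst h)

theorem dyadicExp_spec {s : ℕ × ℕ} (h0 : s.1 ≠ 0) (h1 : (s.1 : ℝ) / 2 ^ s.2 ≤ 1) :
    ((1 : ℝ) / 2) ^ dyadicExp s ≤ (s.1 : ℝ) / 2 ^ s.2 ∧
      (s.1 : ℝ) / 2 ^ s.2 < 2 * ((1 : ℝ) / 2) ^ dyadicExp s := by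
  obtain ⟨N, L⟩ := s
  simp only at h0 h1
  set e := Nat.findGreatest (fun e => 2 ^ e ≤ N) N with he
  have h2 : 2 ^ e ≤ N := Nat.findGreatest_spec (P := fun e => 2 ^ e ≤ N) (Nat.zero_le N)
    (by simpa using Nat.one_le_iff_ne_zero.2 h0)
  have h3 : N < 2 ^ (e + 1) := by
    by_contra hlt
    have h4 : e + 1 ≤ N := (Nat.lt_two_pow_self (n := e + 1)).le.trans (not_lt.1 hlt)
    have := Nat.le_findGreatest (P := fun e => 2 ^ e ≤ N) h4 (not_lt.1 hlt)
    omega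
  have hN : N ≤ 2 ^ L := by
    rw [div_le_one (by positivity)] at h1
    exact_mod_cast h1
  have heL : e ≤ L := (Nat.pow_le_pow_iff_right (by norm_num)).1 (h2.trans hN)
  have h5 : ((1 : ℝ) / 2) ^ dyadicExp (N, L) = 2 ^ e / 2 ^ L := by
    have : dyadicExp (N, L) = L - e := rfl
    rw [this, one_div, inv_pow, eq_div_iff (by positivity), inv_mul_eq_div,
      div_eq_iff (by positivity), ← pow_add]
    congr 1
    omega
  have h2r : (2 : ℝ) ^ e ≤ N := by exact_mod_cast h2
  have h3r : (N : ℝ) < 2 ^ (e + 1) := by exact_mod_cast h3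
  rw [h5]
  constructor
  · simp only
    gcongr
  · rw [← mul_div_assoc, ← pow_succ']
    simp only
    gcongr

/-- The largest power of two up to `N / 2 ^ L`, or `0` if this is `0`. -/
noncomputable def dyadicFloor (s : ℕ × ℕ) : ℝ :=
  if s.1 = 0 then 0 else (1 / 2) ^ dyadicExp s

theorem dyadicFloor_nonneg (s : ℕ × ℕ) : 0 ≤ dyadicFloor s := by
  rw [dyadicFloor]
  split_ifs <;> positivity

theorem dyadicFloor_le {s : ℕ × ℕ} (h1 : (s.1 : ℝ) / 2 ^ s.2 ≤ 1) :
    dyadicFloor s ≤ (s.1 : ℝ) / 2 ^ s.2 := by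
  rw [dyadicFloor]
  split_ifs with h
  · positivity
  · exact (dyadicExp_spec h h1).1

theorem dyadicExp_anti {s t : ℕ × ℕ} (hs : s.1 ≠ 0) (ht : t.1 ≠ 0)
    (hst : (s.1 : ℝ) / 2 ^ s.2 ≤ (t.1 : ℝ) / 2 ^ t.2) (h1 : (t.1 : ℝ) / 2 ^ t.2 ≤ 1) :
    dyadicExp t ≤ dyadicExp s := by
  have h2 := (dyadicExp_spec hs (hst.trans h1)).1
  have h3 := (dyadicExp_spec ht h1).2
  by_contra hlt
  have h4 : ((1 : ℝ) / 2) ^ dyadicExp t ≤ (1 / 2) ^ (dyadicExp s + 1) :=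
    pow_le_pow_of_le_one (by norm_num) (by norm_num) (by omega)
  rw [pow_succ] at h4
  linarith

/-- The requests of the coding theorem: whenever the largest power of two below the mass of a
string `x` grows, to `2 ^ (-k)` say, a codeword of length `k + 1` for `x` is requested. -/
def massRequest (U : Machine) (n : ℕ) : Option (ℕ × List Bool) :=
  (U.halting n).bind fun q =>
    if (U.mass (decList q.2).headI n).1 = 0 ∨ dyadicExp (U.mass (decList q.2).headI n) ≠
        dyadicExp (U.mass (decList q.2).headI (n + 1))
    then some (dyadicExp (U.mass (decList q.2).headI (n + 1)) + 1, (decList q.2).headI)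
    else none

theorem massRequest_computable (U : Machine) : Computable U.massRequest := by
  have hmass : Computable₂ U.mass := dyadicSum_computable U.lengthFor_computable
  have hx : Computable fun a : ℕ × List Bool × List Bool => (decList a.2.2).headI :=
    (Primrec.list_headI.comp (decList_primrec.comp (Primrec.snd.comp Primrec.snd))).to_comp
  have h0 := hmass.comp hx Computable.fst
  have h1 := hmass.comp hx (Computable.succ.comp Computable.fst)
  have h : Primrec fun b : (ℕ × ℕ) × (ℕ × ℕ) × List Bool =>
      if b.1.1 = 0 ∨ dyadicExp b.1 ≠ dyadicExp b.2.1
      then some (dyadicExp b.2.1 + 1, b.2.2) else none := by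
    have h2 : Primrec fun b : (ℕ × ℕ) × (ℕ × ℕ) × List Bool => dyadicExp b.2.1 :=
      dyadicExp_primrec.comp (Primrec.fst.comp Primrec.snd)
    refine Primrec.ite (PrimrecPred.or (Primrec.eq.comp (Primrec.fst.comp Primrec.fst)
      (Primrec.const 0)) (PrimrecPred.not (Primrec.eq.comp
        (dyadicExp_primrec.comp Primrec.fst) h2))) ?_ (Primrec.const none)
    exact Primrec.option_some.comp ((Primrec.succ.comp h2).pair (Primrec.snd.comp Primrec.snd))
  have h3 := h.to_comp.comp (h0.pair (h1.pair hx))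
  exact Computable.option_bind U.halting_computable h3.to₂

theorem lengthFor_eq_none {U : Machine} {x : List Bool} {n : ℕ} (h : U.halting n = none) :
    U.lengthFor x n = none := by
  simp [lengthFor, h]

theorem lengthFor_eq {U : Machine} {x p z : List Bool} {n : ℕ} (h : U.halting n = some (p, z)) :
    U.lengthFor x n = if (decList z).headI = x then some p.length else none := by
  simp [lengthFor, h]

theorem mass_succ_of_none {U : Machine} {x : List Bool} {n : ℕ} (h : U.lengthFor x n = none) :
    U.mass x (n + 1) = U.mass x n := by
  simp [mass, dyadicSum, h]

theorem mass_succ_ne_zero {U : Machine} {x : List Bool} {n l : ℕ}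
    (h : U.lengthFor x n = some l) : (U.mass x (n + 1)).1 ≠ 0 := by
  simp [mass, dyadicSum, h]

theorem mass_eq (U : Machine) (x : List Bool) (n : ℕ) :
    ((U.mass x n).1 : ℝ) / 2 ^ (U.mass x n).2 =
      ∑ j ∈ Finset.range n, weight (U.lengthFor x j) :=
  dyadicSum_eq _ _

theorem mass_mono (U : Machine) (x : List Bool) (n : ℕ) :
    ((U.mass x n).1 : ℝ) / 2 ^ (U.mass x n).2 ≤
      ((U.mass x (n + 1)).1 : ℝ) / 2 ^ (U.mass x (n + 1)).2 := by
  rw [mass_eq, mass_eq, Finset.sum_range_succ]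
  linarith [weight_nonneg (U.lengthFor x n)]

theorem sum_weight_lengthFor_le (U : Machine) (X : Finset (List Bool)) (n : ℕ) :
    ∑ x ∈ X, weight (U.lengthFor x n) ≤ weight ((U.halting n).map fun q => q.1.length) := by
  rcases h : U.halting n with _ | ⟨p, z⟩
  · simp [lengthFor_eq_none h, weight]
  · have h1 : ∀ x ∈ X, weight (U.lengthFor x n) =
        if (decList z).headI = x then (1 / 2 : ℝ) ^ p.length else 0 := by
      intro x _
      rw [lengthFor_eq h]
      split_ifs <;> rfl
    rw [Finset.sum_congr rfl h1, Finset.sum_ite_eq]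
    split_ifs
    · simp [weight]
    · simp [weight]

/-- The exponent of every positive mass has been requested at some stage. -/
theorem exists_massRequest (U : Machine) (x : List Bool) (n : ℕ)
    (h : (U.mass x n).1 ≠ 0) :
    ∃ j, U.massRequest j = some (dyadicExp (U.mass x n) + 1, x) := by
  induction n with
  | zero => simp [mass, dyadicSum] at h
  | succ n ih =>
    rcases hl : U.lengthFor x n with _ | l
    · rw [mass_succ_of_none hl] at h ⊢
      exact ih h
    · rcases hn : U.halting n with _ | ⟨p, z⟩
      · rw [lengthFor_eq_none hn] at hl
        cases hl
      · have hx : (decList z).headI = x := by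
          rw [lengthFor_eq hn] at hl
          by_contra hne
          simp [hne] at hl
        by_cases hc : (U.mass x n).1 = 0 ∨
            dyadicExp (U.mass x n) ≠ dyadicExp (U.mass x (n + 1))
        · refine ⟨n, ?_⟩
          simp only [massRequest, hn, Option.bind_some]
          rw [hx, if_pos hc]
        · rw [not_or, not_not] at hc
          rw [← hc.2]
          exact ih hc.1

namespace IsUniversalPrefix

variable {U : Machine}

theorem sum_mass_le_one (hU : U.IsUniversalPrefix) (X : Finset (List Bool)) (n : ℕ) :
    ∑ x ∈ X, ((U.mass x n).1 : ℝ) / 2 ^ (U.mass x n).2 ≤ 1 := by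
  simp only [mass_eq]
  rw [Finset.sum_comm]
  exact (Finset.sum_le_sum fun j _ => U.sum_weight_lengthFor_le X j).trans
    (hU.sum_halting_le_one n)

theorem mass_le_one (hU : U.IsUniversalPrefix) (x : List Bool) (n : ℕ) :
    ((U.mass x n).1 : ℝ) / 2 ^ (U.mass x n).2 ≤ 1 := by
  simpa using hU.sum_mass_le_one {x} n

theorem dyadicFloor_mass_mono (hU : U.IsUniversalPrefix) (x : List Bool) (n : ℕ) :
    dyadicFloor (U.mass x n) ≤ dyadicFloor (U.mass x (n + 1)) := by
  rcases h : U.lengthFor x n with _ | l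
  · rw [mass_succ_of_none h]
  · have h1 := mass_succ_ne_zero h
    rw [dyadicFloor, dyadicFloor, if_neg h1]
    split_ifs with h0
    · positivity
    · exact pow_le_pow_of_le_one (by norm_num) (by norm_num)
        (dyadicExp_anti h0 h1 (U.mass_mono x n) (hU.mass_le_one x _))

/-- A request is paid for by the growth of the largest power of two below the mass. -/
theorem weight_massRequest_le (hU : U.IsUniversalPrefix) {n : ℕ} {p z : List Bool}
    (h : U.halting n = some (p, z)) :
    weight ((U.massRequest n).map Prod.fst) ≤
      dyadicFloor (U.mass (decList z).headI (n + 1)) -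
        dyadicFloor (U.mass (decList z).headI n) := by
  have hl : U.lengthFor (decList z).headI n = some p.length := by rw [lengthFor_eq h, if_pos rfl]
  set x := (decList z).headI with hx
  have hmono := hU.dyadicFloor_mass_mono x n
  simp only [massRequest, h, Option.bind_some]
  rw [← hx]
  split_ifs with hc
  · have h1 := mass_succ_ne_zero hl
    simp only [Option.map_some, weight]
    rw [dyadicFloor, dyadicFloor, if_neg h1, pow_succ]
    have hpos : (0 : ℝ) < (1 / 2) ^ dyadicExp (U.mass x (n + 1)) := by positivity
    split_ifs with h0
    · linarith
    · have h2 : dyadicExp (U.mass x (n + 1)) + 1 ≤ dyadicExp (U.mass x n) := by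
        have h3 := dyadicExp_anti h0 h1 (U.mass_mono x n) (hU.mass_le_one x _)
        rcases hc with hc | hc
        · exact absurd hc h0
        · omega
      have h4 : ((1 : ℝ) / 2) ^ dyadicExp (U.mass x n) ≤
          (1 / 2) ^ (dyadicExp (U.mass x (n + 1)) + 1) :=
        pow_le_pow_of_le_one (by norm_num) (by norm_num) h2
      rw [pow_succ] at h4
      linarith
  · simp only [Option.map_none, weight]
    linarith

theorem sum_massRequest_le_one (hU : U.IsUniversalPrefix) (N : ℕ) :
    ∑ j ∈ Finset.range N, weight ((U.massRequest j).map Prod.fst) ≤ 1 := by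
  classical
  let X : Finset (List Bool) := (Finset.range N).image fun j =>
    (decList (((U.halting j).map Prod.snd).getD [])).headI
  have key : ∀ n ≤ N, ∑ j ∈ Finset.range n, weight ((U.massRequest j).map Prod.fst) ≤
      ∑ x ∈ X, dyadicFloor (U.mass x n) := by
    intro n
    induction n with
    | zero => intro _; simpa using Finset.sum_nonneg fun x _ => dyadicFloor_nonneg _
    | succ n ih =>
      intro hn
      have h1 := ih (by omega)
      rw [Finset.sum_range_succ]
      have h2 : weight ((U.massRequest n).map Prod.fst) ≤
          ∑ x ∈ X, (dyadicFloor (U.mass x (n + 1)) - dyadicFloor (U.mass x n)) := by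
        have hnn : ∀ x ∈ X, 0 ≤ dyadicFloor (U.mass x (n + 1)) - dyadicFloor (U.mass x n) :=
          fun x _ => sub_nonneg.2 (hU.dyadicFloor_mass_mono x n)
        rcases h : U.halting n with _ | ⟨p, z⟩
        · have : U.massRequest n = none := by simp [massRequest, h]
          simpa [this, weight] using Finset.sum_nonneg hnn
        · refine (hU.weight_massRequest_le h).trans (Finset.single_le_sum hnn ?_)
          exact Finset.mem_image.2 ⟨n, Finset.mem_range.2 (by omega), by simp [h]⟩
      rw [Finset.sum_sub_distrib] at h2
      linarith
  refine (key N le_rfl).trans (le_trans (Finset.sum_le_sum fun x _ => ?_)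
    (hU.sum_mass_le_one X N))
  exact dyadicFloor_le (hU.mass_le_one x N)

/-- The coding theorem: the programs for tuples starting with `x` have total weight
`O(2 ^ (-K(x)))`. -/
theorem exists_sum_lengthFor_le (hU : U.IsUniversalPrefix) :
    ∃ c : ℕ, ∀ (x : List Bool) (n : ℕ),
      ∑ j ∈ Finset.range n, weight (U.lengthFor x j) ≤ 2 ^ c * (1 / 2) ^ U.K x := by
  obtain ⟨c, hc⟩ := hU.kraft_chaitin (R := fun _ => U.massRequest)
    (U.massRequest_computable.comp Computable.snd)
  refine ⟨c + 2, fun x n => ?_⟩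
  rw [← mass_eq]
  by_cases h : (U.mass x n).1 = 0
  · rw [h]
    simp only [Nat.cast_zero, zero_div]
    positivity
  · obtain ⟨j, hj⟩ := U.exists_massRequest x n h
    have h1 : U.K x ≤ dyadicExp (U.mass x n) + 1 + c := hc [] hU.sum_massRequest_le_one j _ _ hj
    have h2 := (dyadicExp_spec h (hU.mass_le_one x n)).2
    have h3 : ((1 : ℝ) / 2) ^ (dyadicExp (U.mass x n) + 1 + c) ≤ (1 / 2) ^ U.K x :=
      pow_le_pow_of_le_one (by norm_num) (by norm_num) h1
    have h4 : (2 : ℝ) ^ (c + 2) * (1 / 2) ^ (dyadicExp (U.mass x n) + 1 + c) =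
        2 * (1 / 2) ^ dyadicExp (U.mass x n) := by
      rw [pow_add, pow_add, pow_add, one_div, inv_pow 2 c]
      field_simp
    refine h2.le.trans (h4.symm.le.trans ?_)
    gcongr

/-! ### Symmetry of information -/

/-- The hard direction of the symmetry of information: `K(x) + K(y | x*) ≤ K(x, y) + O(1)`. -/
theorem exists_K_add_condK_le (hU : U.IsUniversalPrefix) :
    ∃ c : ℕ, ∀ x y p : List Bool, p.length = U.K x → U.Computes p [] x →
      U.K x + U.condK y p ≤ U.K (encList [x, y]) + c := by
  obtain ⟨c, hc⟩ := hU.exists_sum_lengthFor_le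
  -- The auxiliary input codes `p` and `x`.  Where the subtraction truncates, the request is only
  -- lighter than intended; it does so by a bounded amount, as `K(x) ≤ K(x, y) + O(1)`.
  let R : List Bool → ℕ → Option (ℕ × List Bool) := fun v n =>
    (U.halting n).bind fun q => if (decList q.2).headI = (decList v).tail.headI
      then some (q.1.length + c - (decList v).headI.length, (decList q.2).tail.headI) else none
  have hR : Computable₂ R := by
    have h : Primrec fun b : (List Bool × ℕ) × List Bool × List Bool =>
        if (decList b.2.2).headI = (decList b.1.1).tail.headI
        then some (b.2.1.length + c - (decList b.1.1).headI.length, (decList b.2.2).tail.headI)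
        else none := by
      have hz : Primrec fun b : (List Bool × ℕ) × List Bool × List Bool => decList b.2.2 :=
        decList_primrec.comp (Primrec.snd.comp Primrec.snd)
      have hv : Primrec fun b : (List Bool × ℕ) × List Bool × List Bool => decList b.1.1 :=
        decList_primrec.comp (Primrec.fst.comp Primrec.fst)
      refine Primrec.ite (Primrec.eq.comp (Primrec.list_headI.comp hz)
        (Primrec.list_headI.comp (Primrec.list_tail.comp hv))) ?_ (Primrec.const none)
      refine Primrec.option_some.comp (Primrec.pair ?_ (Primrec.list_headI.comp
        (Primrec.list_tail.comp hz)))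
      exact Primrec.nat_sub.comp (Primrec.nat_add.comp (Primrec.list_length.comp
        (Primrec.fst.comp Primrec.snd)) (Primrec.const c))
        (Primrec.list_length.comp (Primrec.list_headI.comp hv))
    exact Computable.option_bind (U.halting_computable.comp Computable.snd) h.to_comp.to₂
  obtain ⟨c₁, hc₁⟩ := hU.kraft_chaitin hR
  -- `p` alone suffices to find `p` and `x`
  obtain ⟨c₂, hc₂⟩ := hU.exists_condK_le_of_mem
    (f := fun p => (U.eval p []).map fun x => encList [p, x])
    (Partrec.map (U.eval_partrec.comp Computable.id (Computable.const []))
      (encList_primrec.to_comp.comp (Computable.list_cons.comp Computable.fst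
        (Computable.list_cons.comp Computable.snd (Computable.const [])))).to₂)
  obtain ⟨c₃, hc₃⟩ := hU.exists_condK_map_le
    (g := fun a => Part.some (decList a.2.1).headI)
    (Primrec.list_headI.comp (decList_primrec.comp (Primrec.fst.comp Primrec.snd))).to_comp
  refine ⟨c + c₁ + c₂ + c₃, fun x y p hpl hp => ?_⟩
  have hsum : ∀ n, ∑ j ∈ Finset.range n,
      weight ((R (encList [p, x]) j).map Prod.fst) ≤ 1 := by
    intro n
    have h1 : ∀ j ∈ Finset.range n, weight ((R (encList [p, x]) j).map Prod.fst) ≤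
        weight (U.lengthFor x j) * ((1 / 2) ^ c * 2 ^ U.K x) := by
      intro j _
      simp only [R, decList_encList, lengthFor, List.headI_cons, List.tail_cons]
      rcases U.halting j with _ | ⟨q, z⟩
      · simp [weight]
      · simp only [Option.bind_some]
        split_ifs with h
        · simp only [Option.map_some, weight]
          have h2 : ((1 : ℝ) / 2) ^ (q.length + c - p.length) =
              (1 / 2) ^ (q.length + c - p.length) * (1 / 2) ^ p.length * 2 ^ p.length := by
            rw [mul_assoc, ← mul_pow]
            norm_num
          have h3 : ((1 : ℝ) / 2) ^ (q.length + c - p.length + p.length) ≤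
              (1 / 2) ^ (q.length + c) :=
            pow_le_pow_of_le_one (by norm_num) (by norm_num) (by omega)
          rw [h2, ← pow_add, ← hpl, ← mul_assoc, ← pow_add]
          gcongr
        · simp [weight]
    refine (Finset.sum_le_sum h1).trans ?_
    rw [← Finset.sum_mul]
    have h2 := hc x n
    have h3 : (2 : ℝ) ^ c * (1 / 2) ^ U.K x * ((1 / 2) ^ c * 2 ^ U.K x) = 1 := by
      rw [mul_mul_mul_comm, ← mul_pow, ← mul_pow]
      norm_num
    refine le_trans ?_ h3.le
    gcongr
  obtain ⟨q, hql, hq⟩ := hU.exists_program (encList [x, y]) []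
  obtain ⟨n, hn⟩ := exists_halting hq
  have h1 := hc₁ (encList [p, x]) hsum n (q.length + c - p.length) y (by
    simp [R, hn, decList_encList])
  have h2 := hc₂ p (encList [p, x]) y (Part.mem_map _ (mem_eval.2 hp))
  have h3 : U.K x ≤ q.length + c₃ := hc₃ q [] (encList [x, y]) x hq (by simp [decList_encList])
  have h4 : U.K (encList [x, y]) = q.length := hql.symm
  omega

end IsUniversalPrefix

end Machine

/-! ### Numbers in binary -/

/-- The number with the given binary digits, least significant digit first. -/
def valLE (z : List Bool) : ℕ :=
  z.foldr (fun b n => 2 * n + b.toNat) 0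

theorem bits_eq_cons {m : ℕ} (h : m ≠ 0) :
    Nat.bits m = decide (m % 2 = 1) :: Nat.bits (m / 2) := by
  rcases Nat.mod_two_eq_zero_or_one m with h2 | h2
  · obtain ⟨k, rfl⟩ : ∃ k, m = 2 * k := ⟨m / 2, by omega⟩
    rw [Nat.bit0_bits k (by omega)]
    simp
  · obtain ⟨k, rfl⟩ : ∃ k, m = 2 * k + 1 := ⟨m / 2, by omega⟩
    rw [Nat.bit1_bits k]
    have h3 : (2 * k + 1) / 2 = k := by omega
    simp [h3]

@[simp]
theorem valLE_bits (m : ℕ) : valLE (Nat.bits m) = m := by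
  induction m using Nat.strong_induction_on with
  | _ m ih =>
    by_cases h : m = 0
    · subst h; simp [valLE]
    · have h1 := ih (m / 2) (by omega)
      rw [bits_eq_cons h]
      change 2 * valLE (Nat.bits (m / 2)) + _ = m
      rw [h1]
      rcases Nat.mod_two_eq_zero_or_one m with h2 | h2 <;> simp [h2] <;> omega

theorem valLE_primrec : Primrec valLE := by
  have h : Primrec₂ fun (_ : List Bool) (q : Bool × ℕ) => 2 * q.2 + q.1.toNat := by
    have h1 : Primrec fun q : List Bool × Bool × ℕ => q.2.1.toNat :=
      (Primrec.dom_finite Bool.toNat).comp (Primrec.fst.comp Primrec.snd)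
    exact Primrec.nat_add.comp (Primrec.nat_mul.comp (Primrec.const 2)
      (Primrec.snd.comp Primrec.snd)) h1
  exact Primrec.list_foldr Primrec.id (Primrec.const 0) h

theorem bits_primrec : Primrec Nat.bits := by
  let f : ℕ × List Bool → ℕ × List Bool := fun s =>
    if s.1 = 0 then s else (s.1 / 2, s.2 ++ [decide (s.1 % 2 = 1)])
  have hf : Primrec f := by
    have h1 : Primrec fun s : ℕ × List Bool => s.1 / 2 :=
      Primrec.nat_div.comp Primrec.fst (Primrec.const 2)
    have h2 : Primrec fun s : ℕ × List Bool => decide (s.1 % 2 = 1) :=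
      (Primrec.eq.comp (Primrec.nat_mod.comp Primrec.fst (Primrec.const 2))
        (Primrec.const 1)).decide
    exact Primrec.ite (Primrec.eq.comp Primrec.fst (Primrec.const 0)) Primrec.id
      (h1.pair (Primrec.list_concat.comp Primrec.snd h2))
  have h : ∀ k m acc, m ≤ k → (f^[k] (m, acc)).2 = acc ++ Nat.bits m := by
    intro k
    induction k with
    | zero =>
      intro m acc hm
      obtain rfl : m = 0 := by omega
      simp
    | succ k ih =>
      intro m acc hm
      rw [Function.iterate_succ_apply]
      by_cases h0 : m = 0
      · simp only [f, h0, if_true]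
        exact ih 0 acc (Nat.zero_le k)
      · simp only [f, h0, if_false]
        rw [ih _ _ (by omega), bits_eq_cons h0, List.append_assoc, List.singleton_append]
  have h2 : Primrec fun m : ℕ => (f^[m] (m, [])).2 :=
    Primrec.snd.comp (Primrec.nat_iterate Primrec.id (Primrec.id.pair (Primrec.const []))
      (hf.comp Primrec.snd).to₂)
  exact h2.of_eq fun m => by rw [h m m [] le_rfl, List.nil_append]

theorem encPair_primrec : Primrec₂ encPair :=
  encList_primrec.comp (Primrec.list_cons.comp (bits_primrec.comp Primrec.fst)
    (Primrec.list_cons.comp (bits_primrec.comp Primrec.snd) (Primrec.const [])))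

theorem valBE_cons (b : Bool) (z : List Bool) :
    valBE (b :: z) = b.toNat * 2 ^ z.length + valBE z := by
  have := valBE_append [b] z
  simpa [valBE] using this

/-- On words of the same length, the lexicographic order is the order of the values. -/
theorem valBE_lt_of_lt {p q : List Bool} (hl : p.length = q.length) (h : p < q) :
    valBE p < valBE q := by
  induction p generalizing q with
  | nil =>
    cases q with
    | nil => exact absurd h (lt_irrefl _)
    | cons b q => simp at hl
  | cons a p ih =>
    cases q with
    | nil => simp at hl
    | cons b q =>
      have hl' : p.length = q.length := by simpa using hl
      rw [valBE_cons, valBE_cons, hl']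
      rcases List.cons_lt_cons_iff.1 h with h1 | ⟨rfl, h1⟩
      · have h2 := valBE_lt p
        rw [hl'] at h2
        obtain ⟨rfl, rfl⟩ : a = false ∧ b = true := by
          revert h1
          cases a <;> cases b <;> decide
        simp only [Bool.toNat_false, Bool.toNat_true]
        omega
      · have := ih hl' h1
        omega

theorem bitsBE_lt {k m n : ℕ} (hmn : m < n) (hn : n < 2 ^ k) : bitsBE k m < bitsBE k n := by
  by_contra h
  rcases (not_lt.1 h).lt_or_eq with h1 | h1
  · have := valBE_lt_of_lt (by simp) h1
    rw [valBE_bitsBE hn, valBE_bitsBE (hmn.trans hn)] at this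
    omega
  · have := congrArg valBE h1
    rw [valBE_bitsBE hn, valBE_bitsBE (hmn.trans hn)] at this
    omega

/-! ### Consequences of the symmetry of information -/

namespace Machine

variable {U : Machine}

namespace IsUniversalPrefix

/-- `K(x | z*) + K(z) ≤ K(x) + K(z | x*) + O(1)`. -/
theorem exists_condK_shortest_add_le (hU : U.IsUniversalPrefix) :
    ∃ c : ℕ, ∀ x z : List Bool, U.condK x (U.shortest z) + U.K z ≤
      U.K x + U.condK z (U.shortest x) + c := by
  obtain ⟨c, hc⟩ := hU.exists_K_add_condK_le
  obtain ⟨d, hd⟩ := hU.exists_condK_le_add (f := fun a => Part.some a.1) Computable.fst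
    (g := fun a => Part.some (encList [a.2.2.1, a.2.1]))
    (encList_primrec.to_comp.comp (Computable.list_cons.comp
      (Computable.fst.comp (Computable.snd.comp Computable.snd))
      (Computable.list_cons.comp (Computable.fst.comp Computable.snd) (Computable.const []))))
  refine ⟨c + d, fun x z => ?_⟩
  obtain ⟨hzl, hz⟩ := hU.shortest_spec z
  obtain ⟨hxl, hx⟩ := hU.shortest_spec x
  have h1 := hc z x _ hzl hz
  obtain ⟨q, hql, hq⟩ := hU.exists_program z (U.shortest x)
  have h2 : U.K (encList [z, x]) ≤ _ := hd _ [] x _ q z _ hx (Part.mem_some _) hq (Part.mem_some _)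
  omega

/-- Given `x*`, a string is as complex as its shortest program. -/
theorem exists_condK_shortest_shortest_le (hU : U.IsUniversalPrefix) :
    ∃ c : ℕ, ∀ x z : List Bool, U.condK (U.shortest z) (U.shortest x) ≤
      U.condK z (U.shortest x) + c := by
  obtain ⟨c, hc⟩ := hU.exists_K_add_condK_le
  obtain ⟨d, hd⟩ := hU.exists_condK_le_add (f := fun a => Part.some a.1) Computable.fst
    (g := fun a => Part.some (encList [a.2.2.1, a.1]))
    (encList_primrec.to_comp.comp (Computable.list_cons.comp
      (Computable.fst.comp (Computable.snd.comp Computable.snd))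
      (Computable.list_cons.comp Computable.fst (Computable.const []))))
  obtain ⟨e, he⟩ := hU.exists_condK_shortest_add_le
  refine ⟨c + d + e, fun x z => ?_⟩
  obtain ⟨hzl, hz⟩ := hU.shortest_spec z
  obtain ⟨hxl, hx⟩ := hU.shortest_spec x
  have h1 := hc x (U.shortest z) _ hxl hx
  obtain ⟨q, hql, hq⟩ := hU.exists_program x (U.shortest z)
  have h2 : U.K (encList [x, U.shortest z]) ≤ _ :=
    hd _ [] z _ q x _ hz (Part.mem_some _) hq (Part.mem_some _)
  have h3 := he x z
  omega

theorem exists_condK_le_K (hU : U.IsUniversalPrefix) :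
    ∃ c : ℕ, ∀ z y : List Bool, U.condK z y ≤ U.K z + c := by
  obtain ⟨c, hc⟩ := hU.exists_condK_le_of_mem (f := fun _ => Part.some []) (Computable.const [])
  exact ⟨c, fun z y => hc y [] z (Part.mem_some _)⟩

/-- `K(m | y) ≤ 2 ⌊log m⌋ + O(1)`. -/
theorem exists_condK_bits_le (hU : U.IsUniversalPrefix) :
    ∃ c : ℕ, ∀ (m : ℕ) (y : List Bool), U.condK (Nat.bits m) y ≤ 2 * Nat.log 2 m + c := by
  obtain ⟨c, hc⟩ := hU.exists_condK_le_length
  refine ⟨c + 2, fun m y => ?_⟩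
  have h1 := (hc (Nat.bits m) y).1
  have h2 : (Nat.bits m).length ≤ Nat.log 2 m + 1 := by
    rw [Nat.size_eq_bits_len, Nat.size_le]
    exact Nat.lt_pow_succ_log_self (by norm_num) m
  omega

/-- Complexities of pairs of numbers. -/
theorem exists_condK_encPair_le (hU : U.IsUniversalPrefix) :
    ∃ c : ℕ, ∀ (a b : ℕ) (y : List Bool), U.condK (encPair a b) y ≤
      2 * Nat.log 2 a + 2 * Nat.log 2 b + c := by
  obtain ⟨c, hc⟩ := hU.exists_condK_bits_le
  obtain ⟨d, hd⟩ := hU.exists_condK_le_add (f := fun a => Part.some a.2.2)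
    (Computable.snd.comp Computable.snd)
    (g := fun a => Part.some (encList [a.2.1, a.2.2.1]))
    (encList_primrec.to_comp.comp (Computable.list_cons.comp
      (Computable.fst.comp Computable.snd) (Computable.list_cons.comp
        (Computable.fst.comp (Computable.snd.comp Computable.snd)) (Computable.const []))))
  refine ⟨2 * c + d, fun a b y => ?_⟩
  obtain ⟨p, hpl, hp⟩ := hU.exists_program (Nat.bits a) y
  obtain ⟨q, hql, hq⟩ := hU.exists_program (Nat.bits b) y
  have h1 := hd p y _ y q _ (encPair a b) hp (Part.mem_some _) hq (Part.mem_some _)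
  have h2 := hc a y
  have h3 := hc b y
  omega

end IsUniversalPrefix

/-! ### The first program to halt can be found -/

/-- The test whether the `n`-th pair of a time and a word of length `a.2`, ordered by time and then
lexicographically, is a halting computation with an output accepted by `T a.1`. -/
def searchTest (U : Machine) {α : Type*} (T : α → List Bool → Bool) (a : α × ℕ) (n : ℕ) : Bool :=
  (U.run (n / 2 ^ a.2) (bitsBE a.2 (n % 2 ^ a.2)) []).elim false (T a.1)

/-- The program of length `a.2` that halts first with an output accepted by `T a.1`. -/
def search (U : Machine) {α : Type*} (T : α → List Bool → Bool) (a : α × ℕ) :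
    Part (List Bool) :=
  (Nat.rfind fun n => Part.some (U.searchTest T a n)).map fun n => bitsBE a.2 (n % 2 ^ a.2)

theorem search_partrec {α : Type*} [Primcodable α] (U : Machine) {T : α → List Bool → Bool}
    (hT : Computable₂ T) : Partrec (U.search T) := by
  have hL : Primrec fun b : (α × ℕ) × ℕ => 2 ^ b.1.2 :=
    nat_pow_primrec.comp (Primrec.const 2) (Primrec.snd.comp Primrec.fst)
  have hw : Primrec fun b : (α × ℕ) × ℕ => bitsBE b.1.2 (b.2 % 2 ^ b.1.2) :=
    bitsBE_primrec.comp (Primrec.snd.comp Primrec.fst) (Primrec.nat_mod.comp Primrec.snd hL)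
  have ht : Primrec fun b : (α × ℕ) × ℕ => b.2 / 2 ^ b.1.2 :=
    Primrec.nat_div.comp Primrec.snd hL
  have hr := U.computable_run ht.to_comp hw.to_comp (Computable.const [])
  have htest : Computable₂ (U.searchTest T) := by
    have h := Computable.option_casesOn hr (Computable.const false)
      (hT.comp (Computable.fst.comp (Computable.fst.comp Computable.fst)) Computable.snd).to₂
    refine h.of_eq fun b => ?_
    rw [searchTest]
    cases U.run (b.2 / 2 ^ b.1.2) (bitsBE b.1.2 (b.2 % 2 ^ b.1.2)) [] <;> rfl
  exact Partrec.map (Partrec.rfind htest.partrec₂) hw.to_comp.to₂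

theorem run_runTime {U : Machine} {p z : List Bool} (h : U.Computes p [] z) :
    U.run (U.runTime p) p [] = some z := by
  obtain ⟨t, ht⟩ := h
  have h1 : U.runTime p ∈ {t | ∃ z, U.run t p [] = some z} := Nat.sInf_mem ⟨t, z, ht⟩
  obtain ⟨w, hw⟩ := h1
  rw [hw, Computes.unique ⟨_, hw⟩ ⟨t, ht⟩]

theorem runTime_le {U : Machine} {p z : List Bool} {t : ℕ} (h : U.run t p [] = some z) :
    U.runTime p ≤ t :=
  Nat.sInf_le ⟨z, h⟩

theorem firstToHalt_mem_search (U : Machine) {α : Type*} (T : α → List Bool → Bool) (a : α)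
    (L : ℕ) {P : Set (List Bool)}
    (hP : ∀ p, p ∈ P ↔ p.length = L ∧ ∃ z, U.Computes p [] z ∧ T a z = true)
    (hne : P.Nonempty) : U.firstToHalt P ∈ U.search T (a, L) := by
  obtain ⟨h1, hmin⟩ := U.firstToHalt_spec P L (fun p hp => ((hP p).1 hp).1) hne
  set p := U.firstToHalt P
  obtain ⟨hlen, z, hz, hTz⟩ := (hP p).1 h1
  have hv : valBE p < 2 ^ L := hlen ▸ valBE_lt p
  have hpos : 0 < 2 ^ L := by positivity
  set n := valBE p + 2 ^ L * U.runTime p with hn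
  have hdiv : n / 2 ^ L = U.runTime p := by
    rw [hn, Nat.add_mul_div_left _ _ hpos, Nat.div_eq_of_lt hv, Nat.zero_add]
  have hmod : n % 2 ^ L = valBE p := by
    rw [hn, Nat.add_mul_mod_self_left, Nat.mod_eq_of_lt hv]
  have hp : bitsBE L (n % 2 ^ L) = p := by rw [hmod, ← hlen, bitsBE_valBE]
  refine (Part.mem_map_iff _).2 ⟨n, Nat.mem_rfind.2 ⟨?_, fun {m} hm => ?_⟩, hp⟩
  · simp [searchTest, hp, hdiv, run_runTime hz, hTz]
  · rw [Part.mem_some_iff, eq_comm, ← Bool.not_eq_true]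
    intro htest
    simp only [searchTest] at htest
    set q := bitsBE L (m % 2 ^ L) with hq
    rcases hr : U.run (m / 2 ^ L) q [] with _ | w
    · simp [hr] at htest
    · rw [hr] at htest
      have hqP : q ∈ P := (hP q).2 ⟨length_bitsBE _ _, w, ⟨_, hr⟩, htest⟩
      have h2 := runTime_le hr
      have h3 : m / 2 ^ L ≤ U.runTime p := hdiv ▸ Nat.div_le_div_right hm.le
      rcases Prod.Lex.le_iff.1 (hmin q hqP) with h4 | ⟨h4, h5⟩
      · simp only [ofLex_toLex] at h4
        omega
      · simp only [ofLex_toLex] at h4 h5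
        have h6 : m % 2 ^ L < valBE p := by
          have h7 := Nat.div_add_mod m (2 ^ L)
          have h8 : m / 2 ^ L = U.runTime p := by omega
          rw [h8] at h7
          omega
        have h9 : valBE q = m % 2 ^ L := valBE_bitsBE (Nat.mod_lt _ hpos)
        rcases h5.lt_or_eq with h10 | h10
        · have := valBE_lt_of_lt (by rw [hlen, hq, length_bitsBE]) h10
          omega
        · rw [← h10] at h9
          omega

namespace IsUniversalPrefix

/-- From `z` and the length of `z*` one finds `z*`, so that
`K(x | z) ≤ K(x | z*) + K(K(z)) + O(1)`. -/
theorem exists_condK_le_condK_shortest (hU : U.IsUniversalPrefix) :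
    ∃ c : ℕ, ∀ x z : List Bool, U.condK x z ≤
      U.condK x (U.shortest z) + U.condK (Nat.bits (U.K z)) z + c := by
  let T : List Bool → List Bool → Bool := fun z w => decide (w = z)
  have hT : Computable₂ T := (Primrec.eq.comp Primrec.snd Primrec.fst).decide.to_comp
  obtain ⟨c, hc⟩ := hU.exists_condK_le_add
    (f := fun a => U.search T (a.2.2, valLE a.2.1))
    ((U.search_partrec hT).comp ((Computable.snd.comp Computable.snd).pair
      (valLE_primrec.comp (Primrec.fst.comp Primrec.snd)).to_comp))
    (g := fun a => Part.some a.2.2.1)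
    (Computable.fst.comp (Computable.snd.comp Computable.snd))
  refine ⟨c, fun x z => ?_⟩
  obtain ⟨p, hpl, hp⟩ := hU.exists_program (Nat.bits (U.K z)) z
  obtain ⟨q, hql, hq⟩ := hU.exists_program x (U.shortest z)
  have h1 : U.shortest z ∈ U.search T (z, valLE (Nat.bits (U.K z))) := by
    rw [valLE_bits]
    refine U.firstToHalt_mem_search T z (U.K z) (fun p => ?_) ⟨_, hU.shortest_spec z⟩
    simp [T]
  have h2 := hc p z _ _ q x x hp h1 hq (Part.mem_some _)
  omega

/-- Conversely `z*` determines `z`. -/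
theorem exists_condK_shortest_le (hU : U.IsUniversalPrefix) :
    ∃ c : ℕ, ∀ x z : List Bool, U.condK x (U.shortest z) ≤ U.condK x z + c := by
  obtain ⟨c, hc⟩ := hU.exists_condK_le_of_mem (f := fun p => U.eval p [])
    (U.eval_partrec.comp Computable.id (Computable.const []))
  exact ⟨c, fun x z => hc _ z x (mem_eval.2 (hU.shortest_spec z).2)⟩

end IsUniversalPrefix

end Machine

/-! ### Deciding whether a string codes a model -/

/-- Two words compare lexicographically at the first position where they differ, a missing bit
being smaller than any bit. -/
theorem lt_iff_exists_take (p q : List Bool) :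
    p < q ↔ ∃ i < q.length, p.take i = q.take i ∧
      (p[i]? = none ∨ (p[i]? = some false ∧ q[i]? = some true)) := by
  induction p generalizing q with
  | nil =>
    cases q with
    | nil => simp
    | cons b q =>
      simp only [List.nil_lt_cons, true_iff]
      exact ⟨0, by simp, rfl, Or.inl rfl⟩
  | cons a p ih =>
    cases q with
    | nil => simp
    | cons b q =>
      rw [List.cons_lt_cons_iff, ih q]
      constructor
      · rintro (h | ⟨rfl, i, hi, h1, h2⟩)
        · refine ⟨0, by simp, rfl, Or.inr ?_⟩
          revert h
          cases a <;> cases b <;> simp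
        · exact ⟨i + 1, by simpa using hi, by simpa using h1, by simpa using h2⟩
      · rintro ⟨i, hi, h1, h2⟩
        cases i with
        | zero =>
          left
          revert h2
          cases a <;> cases b <;> simp
        | succ i =>
          right
          simp only [List.take_succ_cons, List.cons.injEq] at h1
          exact ⟨h1.1, i, by simpa using hi, h1.2, by simpa using h2⟩

theorem lt_primrec : PrimrecRel fun p q : List Bool => p < q := by
  have h : PrimrecRel fun (i : ℕ) (a : List Bool × List Bool) => a.1.take i = a.2.take i ∧
      (a.1[i]? = none ∨ (a.1[i]? = some false ∧ a.2[i]? = some true)) := by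
    have h1 : Primrec fun b : ℕ × List Bool × List Bool => b.2.1 := Primrec.fst.comp Primrec.snd
    have h2 : Primrec fun b : ℕ × List Bool × List Bool => b.2.2 := Primrec.snd.comp Primrec.snd
    have g1 : Primrec fun b : ℕ × List Bool × List Bool => b.2.1[b.1]? :=
      Primrec.list_getElem?.comp h1 Primrec.fst
    have g2 : Primrec fun b : ℕ × List Bool × List Bool => b.2.2[b.1]? :=
      Primrec.list_getElem?.comp h2 Primrec.fst
    exact PrimrecPred.and
      (Primrec.eq.comp (Primrec.list_take.comp Primrec.fst h1)
        (Primrec.list_take.comp Primrec.fst h2))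
      (PrimrecPred.or (Primrec.eq.comp g1 (Primrec.const none))
        (PrimrecPred.and (Primrec.eq.comp g1 (Primrec.const (some false)))
          (Primrec.eq.comp g2 (Primrec.const (some true)))))
  have h3 : PrimrecPred fun a : List Bool × List Bool => ∃ i ∈ List.range a.2.length, _ :=
    h.exists_mem_list.comp (Primrec.list_range.comp (Primrec.list_length.comp Primrec.snd))
      Primrec.id
  exact h3.of_eq fun a => by simp [lt_iff_exists_take a.1 a.2]

theorem pairwise_lt_primrec : PrimrecPred fun l : List (List Bool) => l.Pairwise (· < ·) := by
  have h1 : PrimrecRel fun (i : ℕ) (a : ℕ × List (List Bool)) =>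
      a.2.getD i [] < a.2.getD a.1 [] :=
    lt_primrec.comp
      ((Primrec.list_getD []).comp (Primrec.snd.comp Primrec.snd) Primrec.fst)
      ((Primrec.list_getD []).comp (Primrec.snd.comp Primrec.snd)
        (Primrec.fst.comp Primrec.snd))
  have h2 : PrimrecRel fun (j : ℕ) (l : List (List Bool)) =>
      ∀ i ∈ List.range j, l.getD i [] < l.getD j [] :=
    h1.forall_mem_list.comp (Primrec.list_range.comp Primrec.fst) Primrec.id
  have h3 : PrimrecPred fun l : List (List Bool) => ∀ j ∈ List.range l.length, _ :=
    h2.forall_mem_list.comp (Primrec.list_range.comp Primrec.list_length) Primrec.id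
  refine h3.of_eq fun l => ?_
  rw [List.pairwise_iff_getElem]
  constructor
  · intro h i j hi hj hij
    have := h j (List.mem_range.2 hj) i (List.mem_range.2 hij)
    simp only [id_eq] at this
    rwa [List.getD_eq_getElem _ _ hi, List.getD_eq_getElem _ _ hj] at this
  · intro h j hj i hij
    simp only [id_eq, List.mem_range] at hj hij ⊢
    rw [List.getD_eq_getElem _ _ (hij.trans hj), List.getD_eq_getElem _ _ hj]
    exact h i j (hij.trans hj) hj hij

/-- The test whether `z` codes a model of `a.1` with at most `2 ^ a.2` elements. -/
noncomputable def isModelCode (a : List Bool × ℕ) (z : List Bool) : Bool :=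
  open Classical in
  decide (encList (decList z) = z ∧ (decList z).Pairwise (· < ·) ∧ (∃ w ∈ decList z, w = a.1) ∧
    (decList z).length ≤ 2 ^ a.2)

theorem isModelCode_computable : Computable₂ isModelCode := by
  have hd : Primrec fun b : (List Bool × ℕ) × List Bool => decList b.2 :=
    decList_primrec.comp Primrec.snd
  have h1 : PrimrecPred fun b : (List Bool × ℕ) × List Bool => encList (decList b.2) = b.2 :=
    Primrec.eq.comp (encList_primrec.comp hd) Primrec.snd
  have h2 : PrimrecPred fun b : (List Bool × ℕ) × List Bool => (decList b.2).Pairwise (· < ·) :=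
    pairwise_lt_primrec.comp hd
  have h3 : PrimrecPred fun b : (List Bool × ℕ) × List Bool => ∃ w ∈ decList b.2, w = b.1.1 :=
    (PrimrecRel.exists_mem_list (R := fun w x : List Bool => w = x) Primrec.eq).comp hd
      (Primrec.fst.comp Primrec.fst)
  have h4 : PrimrecPred fun b : (List Bool × ℕ) × List Bool =>
      (decList b.2).length ≤ 2 ^ b.1.2 :=
    Primrec.nat_le.comp (Primrec.list_length.comp hd)
      (nat_pow_primrec.comp (Primrec.const 2) (Primrec.snd.comp Primrec.fst))
  classical
  exact ((h1.and (h2.and (h3.and h4))).decide.of_eq fun b => by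
    unfold isModelCode; congr).to_comp

theorem decList_encSet (S : Finset (List Bool)) : decList (encSet S) = S.sort (· ≤ ·) :=
  decList_encList _

theorem encSet_toFinset {l : List (List Bool)} (h : l.Pairwise (· < ·)) :
    encSet l.toFinset = encList l := by
  have hnd : l.Nodup := h.imp fun h => h.ne
  rw [encSet, (List.toFinset_sort (r := (· ≤ ·)) hnd).2 (h.imp fun h => h.le)]

theorem isModelCode_eq_true {x : List Bool} {h : ℕ} {z : List Bool} :
    isModelCode (x, h) z = true ↔
      ∃ S : Finset (List Bool), x ∈ S ∧ Nat.clog 2 S.card ≤ h ∧ z = encSet S := by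
  simp only [isModelCode, decide_eq_true_eq, exists_eq_right]
  constructor
  · rintro ⟨h1, h2, h3, h4⟩
    refine ⟨(decList z).toFinset, by simpa using h3, ?_, ?_⟩
    · rw [Nat.clog_le_iff_le_pow (by norm_num),
        List.toFinset_card_of_nodup (h2.imp fun h => h.ne)]
      exact h4
    · rw [encSet_toFinset h2, h1]
  · rintro ⟨S, h1, h2, rfl⟩
    rw [decList_encSet]
    refine ⟨rfl, S.sortedLT_sort.pairwise, by simpa using h1, ?_⟩
    rw [Finset.length_sort]
    exact (Nat.clog_le_iff_le_pow (by norm_num)).1 h2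

theorem clog_computable : Computable (Nat.clog 2) := by
  have h : Computable₂ fun (m h : ℕ) => decide (m ≤ 2 ^ h) :=
    (Primrec.nat_le.comp Primrec.fst
      (nat_pow_primrec.comp (Primrec.const 2) Primrec.snd)).decide.to_comp
  refine (Partrec.rfind h.partrec₂).of_eq_tot fun m => Nat.mem_rfind.2 ⟨?_, fun {k} hk => ?_⟩
  · simpa using Nat.le_pow_clog (by norm_num) m
  · simpa using Nat.pow_lt_of_lt_clog hk

/-! ### All strings of a given length -/

/-- The set of all strings of length `n`. -/
def cube (n : ℕ) : Finset (List Bool) :=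
  ((List.range (2 ^ n)).map (bitsBE n)).toFinset

theorem pairwise_map_bitsBE (n : ℕ) : ((List.range (2 ^ n)).map (bitsBE n)).Pairwise (· < ·) := by
  rw [List.pairwise_map]
  refine List.Pairwise.imp_of_mem (fun _ hb hab => ?_) List.pairwise_lt_range
  exact bitsBE_lt hab (List.mem_range.1 hb)

theorem mem_cube_length (x : List Bool) : x ∈ cube x.length := by
  rw [cube, List.mem_toFinset, List.mem_map]
  exact ⟨valBE x, List.mem_range.2 (valBE_lt x), bitsBE_valBE x⟩

theorem card_cube (n : ℕ) : (cube n).card = 2 ^ n := by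
  rw [cube, List.toFinset_card_of_nodup ((pairwise_map_bitsBE n).imp fun h => h.ne)]
  simp

namespace Machine

variable {U : Machine}

namespace IsUniversalPrefix

theorem exists_setK_cube_le (hU : U.IsUniversalPrefix) :
    ∃ c : ℕ, ∀ n : ℕ, U.setK (cube n) ≤ 2 * Nat.log 2 n + c := by
  have hg : Computable fun a : List Bool × List Bool × List Bool =>
      encList ((List.range (2 ^ valLE a.2.1)).map (bitsBE (valLE a.2.1))) := by
    have hv : Primrec fun a : List Bool × List Bool × List Bool => valLE a.2.1 :=
      valLE_primrec.comp (Primrec.fst.comp Primrec.snd)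
    exact (encList_primrec.comp (Primrec.list_map
      (Primrec.list_range.comp (nat_pow_primrec.comp (Primrec.const 2) hv))
      (bitsBE_primrec.comp (hv.comp Primrec.fst) Primrec.snd).to₂)).to_comp
  obtain ⟨c, hc⟩ := hU.exists_condK_map_le hg
  obtain ⟨d, hd⟩ := hU.exists_condK_bits_le
  refine ⟨c + d, fun n => ?_⟩
  obtain ⟨p, hpl, hp⟩ := hU.exists_program (Nat.bits n) []
  have h1 : U.setK (cube n) ≤ p.length + c := hc p [] _ (encSet (cube n)) hp (by
    rw [cube, encSet_toFinset (pairwise_map_bitsBE n)]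
    simp)
  have h2 := hd n []
  omega

/-- A string, its level and its log-size determine the witness at that level. -/
theorem exists_condK_firstToHalt_le (hU : U.IsUniversalPrefix) :
    ∃ c : ℕ, ∀ (x : List Bool) (α h : ℕ) (S : Finset (List Bool)),
      {p | p.length = α ∧ ∃ S : Finset (List Bool),
        x ∈ S ∧ Nat.clog 2 S.card ≤ h ∧ U.Computes p [] (encSet S)}.Nonempty →
      U.Computes (U.firstToHalt {p | p.length = α ∧ ∃ S : Finset (List Bool),
        x ∈ S ∧ Nat.clog 2 S.card ≤ h ∧ U.Computes p [] (encSet S)}) [] (encSet S) →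
      U.condK (encSet S) (U.shortest x) ≤ U.condK (encPair α h) (U.shortest x) + c := by
  have hg : Partrec fun a : List Bool × List Bool × List Bool =>
      (U.eval a.2.2 []).bind fun x => (U.search isModelCode
        ((x, valLE (decList a.2.1).tail.headI), valLE (decList a.2.1).headI)).bind fun p =>
          U.eval p [] := by
    refine Partrec.bind (U.eval_partrec.comp (Computable.snd.comp Computable.snd)
      (Computable.const [])) ?_
    have hd : Primrec fun a : (List Bool × List Bool × List Bool) × List Bool =>
        decList a.1.2.1 :=
      decList_primrec.comp (Primrec.fst.comp (Primrec.snd.comp Primrec.fst))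
    refine Partrec.bind ((U.search_partrec isModelCode_computable).comp
      ((Computable.snd.pair (valLE_primrec.comp (Primrec.list_headI.comp
        (Primrec.list_tail.comp hd))).to_comp).pair
        (valLE_primrec.comp (Primrec.list_headI.comp hd)).to_comp)) ?_
    exact U.eval_partrec.comp Computable.snd (Computable.const [])
  obtain ⟨c, hc⟩ := hU.exists_condK_map_le hg
  refine ⟨c, fun x α h S hne hS => ?_⟩
  obtain ⟨p, hpl, hp⟩ := hU.exists_program (encPair α h) (U.shortest x)
  rw [← hpl]
  refine hc p (U.shortest x) _ _ hp ?_
  simp only [encPair, decList_encList, List.headI_cons, List.tail_cons, valLE_bits,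
    Part.mem_bind_iff]
  refine ⟨x, mem_eval.2 (hU.shortest_spec x).2, _, ?_, mem_eval.2 hS⟩
  refine U.firstToHalt_mem_search isModelCode (x, h) α (fun p => ?_) hne
  simp only [Set.mem_ofPred_eq, isModelCode_eq_true]
  constructor
  · rintro ⟨h1, S, h2, h3, h4⟩
    exact ⟨h1, _, h4, S, h2, h3, rfl⟩
  · rintro ⟨h1, _, h4, S, h2, h3, rfl⟩
    exact ⟨h1, S, h2, h3, h4⟩

/-- The shortest program for a set determines its complexity and its log-size. -/
theorem exists_condK_encPair_le_shortest (hU : U.IsUniversalPrefix) :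
    ∃ c : ℕ, ∀ (S : Finset (List Bool)) (y : List Bool),
      U.condK (encPair (U.setK S) (Nat.clog 2 S.card)) y ≤ U.condK (U.setShortest S) y + c := by
  have hg : Partrec fun a : List Bool × List Bool × List Bool =>
      (U.eval a.2.1 []).map fun z => encPair a.2.1.length (Nat.clog 2 (decList z).length) := by
    have h1 : Computable fun b : (List Bool × List Bool × List Bool) × List Bool =>
        Nat.clog 2 (decList b.2).length :=
      clog_computable.comp (Primrec.list_length.comp (decList_primrec.comp Primrec.snd)).to_comp
    have h2 : Computable fun b : (List Bool × List Bool × List Bool) × List Bool =>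
        b.1.2.1.length :=
      Computable.list_length.comp (Computable.fst.comp (Computable.snd.comp Computable.fst))
    exact Partrec.map (U.eval_partrec.comp (Computable.fst.comp Computable.snd)
      (Computable.const [])) (Computable₂.comp encPair_primrec.to_comp h2 h1).to₂
  obtain ⟨c, hc⟩ := hU.exists_condK_map_le hg
  refine ⟨c, fun S y => ?_⟩
  obtain ⟨p, hpl, hp⟩ := hU.exists_program (U.setShortest S) y
  rw [← hpl]
  refine hc p y _ _ hp ?_
  obtain ⟨h1, h2⟩ := hU.shortest_spec (encSet S)
  have h3 := Part.mem_map (fun z => encPair (U.setShortest S).length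
    (Nat.clog 2 (decList z).length)) (mem_eval.2 h2)
  rw [decList_encSet, Finset.length_sort] at h3
  have h4 : (U.setShortest S).length = U.setK S := h1
  rw [← h4]
  exact h3

end IsUniversalPrefix

end Machine

namespace Machine

variable {U : Machine}

/-! ### The structure function and its drops -/

theorem minLevel_le {x : List Bool} {S : Finset (List Bool)} (hx : x ∈ S) {α : ℕ}
    (hS : U.setK S ≤ α) : U.minLevel x ≤ α :=
  Nat.sInf_le ⟨S, hx, hS⟩

theorem structFun_le {x : List Bool} {S : Finset (List Bool)} (hx : x ∈ S) {α : ℕ}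
    (hS : U.setK S ≤ α) : U.structFun x α ≤ Nat.clog 2 S.card :=
  Nat.sInf_le ⟨S, hx, hS, rfl⟩

theorem exists_structFun_eq {x : List Bool} {α : ℕ} (hα : U.minLevel x ≤ α) :
    ∃ S : Finset (List Bool), x ∈ S ∧ U.setK S ≤ α ∧ Nat.clog 2 S.card = U.structFun x α := by
  obtain ⟨S, hx, hS⟩ : U.minLevel x ∈ {α | ∃ S : Finset (List Bool), x ∈ S ∧ U.setK S ≤ α} :=
    Nat.sInf_mem ⟨_, {x}, Finset.mem_singleton_self x, le_rfl⟩
  exact Nat.sInf_mem (s := {m | ∃ S : Finset (List Bool), x ∈ S ∧ U.setK S ≤ α ∧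
    Nat.clog 2 S.card = m}) ⟨_, S, hx, hS.trans hα, rfl⟩

/-- Either there is a drop at `α + 1` or the last drop stays where it was. -/
theorem lastDrop_succ_cases (U : Machine) (Q : ℕ → ℝ) {x : List Bool} {α : ℕ}
    (hα : U.minLevel x ≤ α) :
    (U.lastDrop Q x (α + 1) = α + 1 ∧
      Q (U.lastDrop Q x α) + (α + 1 : ℕ) + U.structFun x (α + 1) ≤
        U.lastDrop Q x α + U.structFun x (U.lastDrop Q x α)) ∨
    (U.lastDrop Q x (α + 1) = U.lastDrop Q x α ∧
      (U.lastDrop Q x α : ℝ) + U.structFun x (U.lastDrop Q x α) <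
        Q (U.lastDrop Q x α) + (α + 1 : ℕ) + U.structFun x (α + 1)) := by
  have h0 : ¬ α + 1 ≤ U.minLevel x := by omega
  have h1 : U.lastDrop Q x (α + 1) = if Q (U.lastDrop Q x α) ≤
        ((U.lastDrop Q x α : ℝ) + (U.structFun x (U.lastDrop Q x α) : ℝ))
          - ((α + 1 : ℕ) : ℝ) - (U.structFun x (α + 1) : ℝ)
      then α + 1
      else U.lastDrop Q x α := by
    rw [lastDrop, if_neg h0]
  by_cases h : Q (U.lastDrop Q x α) ≤
        ((U.lastDrop Q x α : ℝ) + (U.structFun x (U.lastDrop Q x α) : ℝ))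
          - ((α + 1 : ℕ) : ℝ) - (U.structFun x (α + 1) : ℝ)
  · rw [if_pos h] at h1
    exact Or.inl ⟨h1, by linarith⟩
  · rw [if_neg h] at h1
    exact Or.inr ⟨h1, by linarith⟩

theorem lastDrop_minLevel (U : Machine) (Q : ℕ → ℝ) (x : List Bool) :
    U.lastDrop Q x (U.minLevel x) = U.minLevel x := by
  rcases h : U.minLevel x with _ | m
  · rw [lastDrop, h]
  · rw [lastDrop, if_pos h.ge, h]

theorem lastDrop_bounds (U : Machine) (Q : ℕ → ℝ) {x : List Bool} {α : ℕ}
    (hα : U.minLevel x ≤ α) :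
    U.minLevel x ≤ U.lastDrop Q x α ∧ U.lastDrop Q x α ≤ α := by
  induction α, hα using Nat.le_induction with
  | base => simp [lastDrop_minLevel]
  | succ α hα ih =>
    rcases U.lastDrop_succ_cases Q hα with ⟨h, -⟩ | ⟨h, -⟩ <;> rw [h]
    · omega
    · omega

theorem lastDrop_idem (U : Machine) (Q : ℕ → ℝ) {x : List Bool} {α : ℕ}
    (hα : U.minLevel x ≤ α) : U.lastDrop Q x (U.lastDrop Q x α) = U.lastDrop Q x α := by
  induction α, hα using Nat.le_induction with
  | base => simp [lastDrop_minLevel]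
  | succ α hα ih =>
    rcases U.lastDrop_succ_cases Q hα with ⟨h, -⟩ | ⟨h, -⟩
    · rw [h, h]
    · rw [h, ih]

theorem isDropLevel_iff {Q : ℕ → ℝ} {x : List Bool} {a : ℕ} :
    U.IsDropLevel Q x a ↔ U.minLevel x ≤ a ∧ U.lastDrop Q x a = a := by
  constructor
  · rintro ⟨α, hα, rfl⟩
    exact ⟨(U.lastDrop_bounds Q hα).1, U.lastDrop_idem Q hα⟩
  · rintro ⟨h1, h2⟩
    exact ⟨a, h1, h2⟩

/-- The last drop at or before `α` is the largest drop level up to `α`. -/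
theorem IsDropLevel.le_lastDrop {Q : ℕ → ℝ} {x : List Bool} {a α : ℕ}
    (ha : U.IsDropLevel Q x a) (haα : a ≤ α) : a ≤ U.lastDrop Q x α := by
  obtain ⟨h1, h2⟩ := isDropLevel_iff.1 ha
  induction α, haα using Nat.le_induction with
  | base => exact h2.ge
  | succ α hα ih =>
    rcases U.lastDrop_succ_cases Q (h1.trans hα) with ⟨h, -⟩ | ⟨h, -⟩ <;> rw [h]
    · omega
    · exact ih

/-- Where there is no drop, the threshold has not been reached. -/
theorem lt_of_lastDrop_lt {Q : ℕ → ℝ} {x : List Bool} {α : ℕ} (hα : U.minLevel x ≤ α)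
    (h : U.lastDrop Q x α < α) :
    (U.lastDrop Q x α : ℝ) + U.structFun x (U.lastDrop Q x α) <
      Q (U.lastDrop Q x α) + α + U.structFun x α := by
  have h1 := (U.lastDrop_bounds Q hα).1
  obtain ⟨β, rfl⟩ : ∃ β, α = β + 1 := ⟨α - 1, by omega⟩
  rcases U.lastDrop_succ_cases Q (show U.minLevel x ≤ β by omega) with ⟨h2, -⟩ | ⟨h2, h3⟩
  · omega
  · rw [h2]
    exact h3

/-- At a drop level the structure function is smaller than before: simpler models are larger. -/
theorem IsDropLevel.structFun_lt {Q : ℕ → ℝ} {x : List Bool}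
    (hQ : ∀ α, U.minLevel x ≤ α → 0 ≤ Q α) {a : ℕ} (ha : U.IsDropLevel Q x a)
    {S : Finset (List Bool)} (hx : x ∈ S) (hS : U.setK S < a) :
    U.structFun x a < Nat.clog 2 S.card := by
  obtain ⟨h1, h2⟩ := isDropLevel_iff.1 ha
  have h3 : U.minLevel x ≤ U.setK S := minLevel_le hx le_rfl
  obtain ⟨β, rfl⟩ : ∃ β, a = β + 1 := ⟨a - 1, by omega⟩
  have hβ : U.minLevel x ≤ β := by omega
  refine lt_of_lt_of_le ?_ (structFun_le hx (Nat.lt_succ_iff.1 hS))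
  obtain ⟨hk1, hk2⟩ := U.lastDrop_bounds Q hβ
  have hQk := hQ _ hk1
  rcases U.lastDrop_succ_cases Q hβ with ⟨-, h4⟩ | ⟨h4, -⟩
  · have h5 : (U.structFun x (β + 1) : ℝ) < U.structFun x β := by
      push_cast at h4
      rcases hk2.lt_or_eq with h6 | h6
      · have h7 := lt_of_lastDrop_lt hβ h6
        linarith
      · rw [h6] at h4 hQk
        linarith
    exact_mod_cast h5
  · omega

/-- The witness at a drop level: it has complexity exactly `a`, and it is what the first program of
length `a` to halt with a small model outputs. -/
theorem IsUniversalPrefix.witness_spec (hU : U.IsUniversalPrefix) {Q : ℕ → ℝ} {x : List Bool}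
    (hQ : ∀ α, U.minLevel x ≤ α → 0 ≤ Q α) {a : ℕ} (ha : U.IsDropLevel Q x a) :
    {p | p.length = a ∧ ∃ S : Finset (List Bool), x ∈ S ∧
      Nat.clog 2 S.card ≤ U.structFun x a ∧ U.Computes p [] (encSet S)}.Nonempty ∧
    U.Computes (U.firstToHalt {p | p.length = a ∧ ∃ S : Finset (List Bool), x ∈ S ∧
      Nat.clog 2 S.card ≤ U.structFun x a ∧ U.Computes p [] (encSet S)}) []
        (encSet (U.witness x a)) ∧
    x ∈ U.witness x a ∧ U.setK (U.witness x a) = a ∧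
    Nat.clog 2 (U.witness x a).card = U.structFun x a := by
  set P := {p | p.length = a ∧ ∃ S : Finset (List Bool), x ∈ S ∧
      Nat.clog 2 S.card ≤ U.structFun x a ∧ U.Computes p [] (encSet S)} with hP
  have hne : P.Nonempty := by
    obtain ⟨S, hx, hS, hcl⟩ := exists_structFun_eq (isDropLevel_iff.1 ha).1
    have hS' : U.setK S = a := by
      refine le_antisymm hS (not_lt.1 fun hlt => ?_)
      have := ha.structFun_lt hQ hx hlt
      omega
    obtain ⟨p, hpl, hp⟩ := hU.exists_program (encSet S) []
    exact ⟨p, hpl.trans hS', S, hx, hcl.le, hp⟩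
  obtain ⟨h1, S, hx, hcl, hS⟩ := (U.firstToHalt_spec P a (fun p hp => hp.1) hne).1
  have hw : U.Computes (U.firstToHalt P) [] (encSet (U.witness x a)) :=
    Classical.epsilon_spec
      (p := fun S : Finset (List Bool) => U.Computes (U.firstToHalt P) [] (encSet S)) ⟨S, hS⟩
  have he : U.witness x a = S := encSet_injective (hw.unique hS)
  have hK : U.setK S ≤ a := h1 ▸ condK_le_of_computes hS
  refine ⟨hne, hw, he ▸ hx, ?_, ?_⟩
  · rw [he]
    refine le_antisymm hK (not_lt.1 fun hlt => ?_)
    have := ha.structFun_lt hQ hx hlt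
    omega
  · rw [he]
    exact le_antisymm hcl (structFun_le hx hK)

/-- Consecutive drop levels. -/
theorem level_spec {Q : ℕ → ℝ} {x : List Bool} {i : ℕ} (hi : 2 ≤ i)
    (hM : (i : ℕ∞) ≤ U.numModels Q x) :
    U.IsDropLevel Q x (U.level Q x (i - 1)) ∧ U.IsDropLevel Q x (U.level Q x i) ∧
      U.level Q x (i - 1) < U.level Q x i ∧
      U.lastDrop Q x (U.level Q x i - 1) = U.level Q x (i - 1) := by
  obtain ⟨j, rfl⟩ : ∃ j, i = j + 2 := ⟨i - 2, by omega⟩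
  have e1 : U.level Q x (j + 2 - 1) = Nat.nth (U.IsDropLevel Q x) j := rfl
  have e2 : U.level Q x (j + 2) = Nat.nth (U.IsDropLevel Q x) (j + 1) := rfl
  rw [e1, e2]
  have hcard : ∀ hf : (Set.ofPred (U.IsDropLevel Q x)).Finite, j + 1 < hf.toFinset.card := by
    intro hf
    have h1 : U.numModels Q x = hf.toFinset.card := hf.encard_eq_coe_toFinset_card
    rw [h1] at hM
    have : j + 2 ≤ hf.toFinset.card := by exact_mod_cast hM
    omega
  have ha := Nat.nth_mem j fun hf => (Nat.lt_succ_self j).trans (hcard hf)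
  have hb := Nat.nth_mem (j + 1) hcard
  have hab := Nat.nth_lt_nth' (Nat.lt_succ_self j) hcard
  refine ⟨ha, hb, hab, ?_⟩
  set a := Nat.nth (U.IsDropLevel Q x) j
  set b := Nat.nth (U.IsDropLevel Q x) (j + 1) with hb'
  have hβ : U.minLevel x ≤ b - 1 := (isDropLevel_iff.1 ha).1.trans (by omega)
  refine le_antisymm ?_ (ha.le_lastDrop (by omega))
  refine Nat.le_nth_of_lt_nth_succ ?_ ⟨b - 1, hβ, rfl⟩
  have := (U.lastDrop_bounds Q hβ).2
  rw [← hb']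
  omega

/-- From one drop level to the next, the total length of the two-part code does not grow. -/
theorem level_add_structFun_le {Q : ℕ → ℝ} {x : List Bool}
    (hQ : ∀ α, U.minLevel x ≤ α → 0 ≤ Q α) {i : ℕ} (hi : 2 ≤ i)
    (hM : (i : ℕ∞) ≤ U.numModels Q x) :
    U.level Q x i + U.structFun x (U.level Q x i) ≤
      U.level Q x (i - 1) + U.structFun x (U.level Q x (i - 1)) := by
  obtain ⟨ha, hb, hab, hl⟩ := level_spec hi hM
  generalize U.level Q x i = b at *
  generalize U.level Q x (i - 1) = a at *
  have hmin := (isDropLevel_iff.1 ha).1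
  obtain ⟨β, rfl⟩ : ∃ β, b = β + 1 := ⟨b - 1, by omega⟩
  rw [Nat.add_sub_cancel] at hl
  rcases U.lastDrop_succ_cases Q (show U.minLevel x ≤ β by omega) with ⟨-, h⟩ | ⟨h, -⟩
  · rw [hl] at h
    have := hQ a hmin
    have h2 : ((β + 1 : ℕ) : ℝ) + U.structFun x (β + 1) ≤ a + U.structFun x a := by linarith
    exact_mod_cast h2
  · have := (isDropLevel_iff.1 hb).2
    omega

theorem IsDropLevel.modelAt_eq {c : ℕ} {Q : ℕ → ℝ} {x : List Bool} {a : ℕ}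
    (ha : U.IsDropLevel Q x a) : U.modelAt c Q x a = U.witness x a := by
  rw [modelAt, if_pos (isDropLevel_iff.1 ha).2]

/-! ### Deficiency at a drop level -/

namespace IsUniversalPrefix

/-- The complexity of the witness at a drop level `a`, given `x*`, is that of `a` and the
log-size of the witness. -/
theorem exists_condK_witness_bounds (hU : U.IsUniversalPrefix) :
    ∃ C : ℕ, ∀ (x : List Bool) (Q : ℕ → ℝ), (∀ α, U.minLevel x ≤ α → 0 ≤ Q α) →
      ∀ a, U.IsDropLevel Q x a →
        U.condK (encSet (U.witness x a)) (U.shortest x) ≤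
            U.condK (encPair a (Nat.clog 2 (U.witness x a).card)) (U.shortest x) + C ∧
          U.condK (encPair a (Nat.clog 2 (U.witness x a).card)) (U.shortest x) ≤
            U.condK (encSet (U.witness x a)) (U.shortest x) + C := by
  obtain ⟨c₁, h₁⟩ := hU.exists_condK_firstToHalt_le
  obtain ⟨c₂, h₂⟩ := hU.exists_condK_encPair_le_shortest
  obtain ⟨c₃, h₃⟩ := hU.exists_condK_shortest_shortest_le
  refine ⟨c₁ + c₂ + c₃, fun x Q hQ a ha => ?_⟩
  obtain ⟨hne, hcomp, -, hK, hcl⟩ := hU.witness_spec hQ ha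
  have e1 := h₁ x a _ _ hne hcomp
  have e2 := h₂ (U.witness x a) (U.shortest x)
  have e3 := h₃ x (encSet (U.witness x a))
  rw [hK] at e2
  rw [← hcl] at e1
  have e4 : U.setShortest (U.witness x a) = U.shortest (encSet (U.witness x a)) := rfl
  rw [e4] at e2
  exact ⟨by omega, by omega⟩

/-- The strong deficiency of the witness at a drop level, by the symmetry of information. -/
theorem exists_abs_strongDeficiency_sub_le (hU : U.IsUniversalPrefix) :
    ∃ C : ℝ, ∀ (x : List Bool) (Q : ℕ → ℝ), (∀ α, U.minLevel x ≤ α → 0 ≤ Q α) →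
      ∀ a, U.IsDropLevel Q x a →
        |U.strongDeficiency x (U.witness x a) - (Real.logb 2 (U.witness x a).card - U.K x -
          U.condK (encPair a (Nat.clog 2 (U.witness x a).card)) (U.shortest x) + a)| ≤ C := by
  obtain ⟨c₁, h₁⟩ := hU.exists_condK_witness_bounds
  obtain ⟨c₂, h₂⟩ := hU.exists_condK_shortest_add_le
  refine ⟨c₁ + c₂, fun x Q hQ a ha => ?_⟩
  obtain ⟨-, -, -, hK, -⟩ := hU.witness_spec hQ ha
  obtain ⟨e1, e2⟩ := h₁ x Q hQ a ha
  have e3 := h₂ x (encSet (U.witness x a))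
  have e4 := h₂ (encSet (U.witness x a)) x
  have hK' : U.K (encSet (U.witness x a)) = a := hK
  rw [hK'] at e3 e4
  have e5 : U.setShortest (U.witness x a) = U.shortest (encSet (U.witness x a)) := rfl
  rw [strongDeficiency, e5]
  have f1 : (U.condK (encSet (U.witness x a)) (U.shortest x) : ℝ) ≤
      U.condK (encPair a (Nat.clog 2 (U.witness x a).card)) (U.shortest x) + c₁ := by
    exact_mod_cast e1
  have f2 : (U.condK (encPair a (Nat.clog 2 (U.witness x a).card)) (U.shortest x) : ℝ) ≤
      U.condK (encSet (U.witness x a)) (U.shortest x) + c₁ := by exact_mod_cast e2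
  have f3 : (U.condK x (U.shortest (encSet (U.witness x a))) : ℝ) + a ≤
      U.K x + U.condK (encSet (U.witness x a)) (U.shortest x) + c₂ := by exact_mod_cast e3
  have f4 : (U.condK (encSet (U.witness x a)) (U.shortest x) : ℝ) + U.K x ≤
      a + U.condK x (U.shortest (encSet (U.witness x a))) + c₂ := by exact_mod_cast e4
  rw [abs_le]
  constructor <;> linarith

end IsUniversalPrefix

end Machine

/-! ### The size of an index model -/

theorem rankIn_lt_rankIn {S : Finset (List Bool)} {y z : List Bool} (hy : y ∈ S) (hyz : y < z) :
    rankIn S y < rankIn S z := by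
  refine Finset.card_lt_card ⟨fun w hw => ?_, fun h => ?_⟩
  · rw [Finset.mem_filter] at hw ⊢
    exact ⟨hw.1, hw.2.trans hyz⟩
  · have := h (Finset.mem_filter.2 ⟨hy, hyz⟩)
    exact lt_irrefl _ (Finset.mem_filter.1 this).2

theorem rankIn_lt_card {S : Finset (List Bool)} {y : List Bool} (hy : y ∈ S) :
    rankIn S y < S.card :=
  Finset.card_lt_card ⟨Finset.filter_subset _ _, fun h =>
    lt_irrefl _ (Finset.mem_filter.1 (h hy)).2⟩

theorem rankIn_injOn (S : Finset (List Bool)) : Set.InjOn (rankIn S) S := by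
  intro y hy z hz h
  rcases lt_trichotomy y z with h1 | h1 | h1
  · exact absurd h (rankIn_lt_rankIn hy h1).ne
  · exact h1
  · exact absurd h (rankIn_lt_rankIn hz h1).ne'

theorem image_rankIn (S : Finset (List Bool)) : S.image (rankIn S) = Finset.range S.card := by
  refine Finset.eq_of_subset_of_card_le (fun r hr => ?_) ?_
  · obtain ⟨y, hy, rfl⟩ := Finset.mem_image.1 hr
    exact Finset.mem_range.2 (rankIn_lt_card hy)
  · rw [Finset.card_image_of_injOn (rankIn_injOn S), Finset.card_range]

/-- The ranks `r < N` with a given integer part of `D r / N` form an interval of length about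
`N / D`. -/
theorem card_filter_mul_div_bounds {N D v : ℕ} (hN : 0 < N) (hv : v < D) :
    N < ((Finset.range N).filter fun r => D * r / N = v).card * D + D ∧
      ((Finset.range N).filter fun r => D * r / N = v).card * D < N + D := by
  have hD : 0 < D := by omega
  set lo := (v * N + (D - 1)) / D with hlo
  set hi := ((v + 1) * N + (D - 1)) / D with hhi
  have lo1 : v * N ≤ lo * D := by
    have := Nat.lt_div_mul_add (a := v * N + (D - 1)) hD
    rw [← hlo] at this
    omega
  have lo2 : lo * D ≤ v * N + (D - 1) := Nat.div_mul_le_self _ _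
  have hi1 : (v + 1) * N ≤ hi * D := by
    have := Nat.lt_div_mul_add (a := (v + 1) * N + (D - 1)) hD
    rw [← hhi] at this
    omega
  have hi2 : hi * D ≤ (v + 1) * N + (D - 1) := Nat.div_mul_le_self _ _
  have hceil : ∀ m r, (m + (D - 1)) / D ≤ r ↔ m ≤ D * r := by
    intro m r
    rw [← Nat.lt_succ_iff, Nat.div_lt_iff_lt_mul hD, Nat.succ_mul, mul_comm r D]
    omega
  have hset : ((Finset.range N).filter fun r => D * r / N = v) = Finset.Ico lo hi := by
    ext r
    have h1 : D * r / N = v ↔ v * N ≤ D * r ∧ D * r < v * N + N := by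
      rw [Nat.div_eq_iff hN]
      omega
    have h2 := hceil ((v + 1) * N) r
    rw [← hhi, add_mul, one_mul] at h2
    rw [Finset.mem_filter, Finset.mem_range, Finset.mem_Ico, h1, hceil,
      show r < hi ↔ ¬ hi ≤ r from not_le.symm, h2]
    have h3 : v * N + N ≤ D * N := by
      calc v * N + N = (v + 1) * N := by ring
        _ ≤ D * N := Nat.mul_le_mul_right N hv
    constructor
    · rintro ⟨-, h4, h5⟩
      omega
    · rintro ⟨h4, h5⟩
      refine ⟨?_, h4, by omega⟩
      by_contra h6
      have h7 : D * N ≤ D * r := Nat.mul_le_mul_left D (not_lt.1 h6)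
      omega
  rw [hset, Nat.card_Ico, Nat.sub_mul]
  have hle : lo * D ≤ hi * D := by
    refine Nat.mul_le_mul_right D (Nat.div_le_div_right ?_)
    rw [add_mul, one_mul]
    omega
  rw [add_mul, one_mul] at hi1 hi2
  omega

/-- Each of the first bits of index halves a model, up to a factor of two in total. -/
theorem abs_logb_card_indexModel_sub_le {S : Finset (List Bool)} {x : List Bool} (hx : x ∈ S)
    {i : ℕ} (hi : 2 ^ i ≤ S.card) :
    |Real.logb 2 (indexModel S x i).card - (Real.logb 2 S.card - i)| ≤ 1 := by
  have hN : 0 < S.card := Finset.card_pos.2 ⟨x, hx⟩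
  set v := 2 ^ i * rankIn S x / S.card with hv
  have hvlt : v < 2 ^ i := by
    rw [hv, Nat.div_lt_iff_lt_mul hN]
    exact Nat.mul_lt_mul_of_pos_left (rankIn_lt_card hx) (by positivity)
  have hcard : (indexModel S x i).card =
      ((Finset.range S.card).filter fun r => 2 ^ i * r / S.card = v).card := by
    rw [← image_rankIn, Finset.filter_image, Finset.card_image_of_injOn]
    · rfl
    · exact (rankIn_injOn S).mono fun y hy => (Finset.mem_filter.1 hy).1
  obtain ⟨h1, h2⟩ := card_filter_mul_div_bounds hN hvlt
  rw [← hcard] at h1 h2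
  have hpos : 0 < (indexModel S x i).card :=
    Finset.card_pos.2 ⟨x, Finset.mem_filter.2 ⟨hx, rfl⟩⟩
  set m := (indexModel S x i).card
  have h3 : S.card ≤ 2 * (m * 2 ^ i) := by
    have : 1 * 2 ^ i ≤ m * 2 ^ i := Nat.mul_le_mul_right _ hpos
    omega
  have h4 : m * 2 ^ i ≤ 2 * S.card := by omega
  have hm : (0 : ℝ) < m := by exact_mod_cast hpos
  have hS : (0 : ℝ) < S.card := by exact_mod_cast hN
  have h3r : (S.card : ℝ) ≤ 2 * (m * 2 ^ i) := by exact_mod_cast h3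
  have h4r : (m : ℝ) * 2 ^ i ≤ 2 * S.card := by exact_mod_cast h4
  have e1 : Real.logb 2 (2 * (m * 2 ^ i)) = 1 + (Real.logb 2 m + i) := by
    rw [Real.logb_mul (by norm_num) (by positivity), Real.logb_mul hm.ne' (by positivity),
      Real.logb_pow, Real.logb_self_eq_one (by norm_num), mul_one]
  have e2 : Real.logb 2 (m * 2 ^ i) = Real.logb 2 m + i := by
    rw [Real.logb_mul hm.ne' (by positivity), Real.logb_pow,
      Real.logb_self_eq_one (by norm_num), mul_one]
  have e3 : Real.logb 2 (2 * (S.card : ℝ)) = 1 + Real.logb 2 S.card := by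
    rw [Real.logb_mul (by norm_num) hS.ne', Real.logb_self_eq_one (by norm_num)]
  have f1 := Real.logb_le_logb_of_le (b := 2) (by norm_num) hS h3r
  have f2 := Real.logb_le_logb_of_le (b := 2) (by norm_num) (by positivity) h4r
  rw [e1] at f1
  rw [e2, e3] at f2
  rw [abs_le]
  constructor <;> linarith

theorem four_mul_log_le (m : ℕ) : 4 * Nat.log 2 m ≤ m + 8 := by
  have key : ∀ k : ℕ, 4 * k ≤ 2 ^ k + 8 := by
    intro k
    induction k with
    | zero => norm_num
    | succ k ih =>
      rcases lt_or_ge k 2 with h | h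
      · interval_cases k <;> norm_num
      · have : 2 ^ 2 ≤ 2 ^ k := Nat.pow_le_pow_right (by norm_num) h
        rw [pow_succ]
        omega
  rcases Nat.eq_zero_or_pos m with h | h
  · subst h; simp
  · have := Nat.pow_log_le_self 2 h.ne'
    have := key (Nat.log 2 m)
    omega

/-! ### The number of index bits and the height of a drop -/

namespace Machine

variable {U : Machine}

theorem indexBits_le (U : Machine) (c γ : ℕ) : U.indexBits c γ ≤ γ := by
  rcases Set.eq_empty_or_nonempty {i | i + U.natK i + c ≤ γ} with h | h
  · rw [indexBits, h]
    simp
  · refine csSup_le h fun i hi => ?_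
    have hi' : i + U.natK i + c ≤ γ := hi
    omega

namespace IsUniversalPrefix

/-- The number of index bits is as large as possible up to a constant, unless `γ` is bounded. -/
theorem exists_indexBits_cases (hU : U.IsUniversalPrefix) (c : ℕ) :
    ∃ e₀ : ℕ, ∀ γ, γ ≤ e₀ ∨ ∃ e ≤ e₀,
      γ + 1 = U.indexBits c γ + U.natK (U.indexBits c γ) + e := by
  obtain ⟨d, hd⟩ := hU.exists_condK_map_le
    (g := fun a => Part.some (Nat.bits (valLE a.2.1 + 1)))
    (bits_primrec.comp (Primrec.succ.comp (valLE_primrec.comp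
      (Primrec.fst.comp Primrec.snd)))).to_comp
  refine ⟨U.natK 0 + c + d + 1, fun γ => ?_⟩
  have hbdd : BddAbove {i | i + U.natK i + c ≤ γ} :=
    ⟨γ, fun i hi => by
      have hi' : i + U.natK i + c ≤ γ := hi
      omega⟩
  rcases Set.eq_empty_or_nonempty {i | i + U.natK i + c ≤ γ} with h | h
  · left
    have h0 : 0 ∉ {i | i + U.natK i + c ≤ γ} := by rw [h]; exact Set.notMem_empty 0
    have h0' : ¬ 0 + U.natK 0 + c ≤ γ := h0
    omega
  · right
    set i := U.indexBits c γ with hi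
    have h1 : i + U.natK i + c ≤ γ := Nat.sSup_mem h hbdd
    have h2 : ¬ (i + 1) + U.natK (i + 1) + c ≤ γ := by
      intro h2
      have : i + 1 ≤ i := le_csSup hbdd h2
      omega
    obtain ⟨p, hpl, hp⟩ := hU.exists_program (Nat.bits i) []
    have h3 : U.natK (i + 1) ≤ p.length + d := hd p [] _ _ hp (by simp)
    have h4 : U.natK i = p.length := hpl.symm
    refine ⟨γ + 1 - i - U.natK i, by omega, by omega⟩

/-- Spending `γ` bits on index bits yields `γ - K(γ) + O(1)` of them.  Adding the complexity of a
number to the number does not change its complexity by more than a constant, since a shortest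
program for `i` also provides its own length, and conversely the error `t` in guessing `K(i)` to
be `K(i + K(i))` has complexity at least `t - O(1)`, which bounds `t`. -/
theorem exists_abs_indexBits_sub_le (hU : U.IsUniversalPrefix) (c : ℕ) :
    ∃ C : ℝ, ∀ γ : ℕ,
      |(U.indexBits c γ : ℝ) - ((γ + 1 : ℕ) - U.natK (γ + 1))| ≤ C := by
  obtain ⟨e₀, he₀⟩ := hU.exists_indexBits_cases c
  obtain ⟨c₁, h₁⟩ := hU.exists_condK_bits_le
  -- from `i*` and `e` to `i + K(i) + e`
  obtain ⟨c₂, h₂⟩ := hU.exists_condK_le_add (f := fun _ => Part.some []) (Computable.const [])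
    (g := fun a => Part.some (Nat.bits (valLE a.2.1 + a.1.length + valLE a.2.2.1)))
    (bits_primrec.comp (Primrec.nat_add.comp (Primrec.nat_add.comp
      (valLE_primrec.comp (Primrec.fst.comp Primrec.snd)) (Primrec.list_length.comp Primrec.fst))
      (valLE_primrec.comp (Primrec.fst.comp (Primrec.snd.comp Primrec.snd))))).to_comp
  -- `K(m) ≤ K(i) + s` for `m = i + K(i) + e`, so that the error `t` below is a natural number
  set s := 2 * e₀ + c₁ + c₂ with hs
  -- from `m*` and `t` back to `i = m + s - t - K(m)`
  obtain ⟨c₃, h₃⟩ := hU.exists_condK_le_add (f := fun _ => Part.some []) (Computable.const [])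
    (g := fun a => Part.some (Nat.bits (valLE a.2.1 + s - valLE a.2.2.1 - a.1.length)))
    (bits_primrec.comp (Primrec.nat_sub.comp (Primrec.nat_sub.comp (Primrec.nat_add.comp
      (valLE_primrec.comp (Primrec.fst.comp Primrec.snd)) (Primrec.const s))
      (valLE_primrec.comp (Primrec.fst.comp (Primrec.snd.comp Primrec.snd))))
      (Primrec.list_length.comp Primrec.fst))).to_comp
  refine ⟨(4 * e₀ + c₁ + 4 + (8 + 2 * (c₁ + c₃ + e₀ + s)) + 2 * s + e₀ : ℕ), fun γ => ?_⟩
  set i := U.indexBits c γ with hi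
  set m := γ + 1 with hm
  have hKm : U.natK m ≤ 2 * Nat.log 2 m + c₁ := h₁ m []
  have hlogm : Nat.log 2 m ≤ m := Nat.log_le_self 2 m
  have hi_le : i ≤ γ := U.indexBits_le c γ
  rcases he₀ γ with hγ | ⟨e, he, hsum⟩
  · rw [abs_le]
    have e1 : (i : ℝ) ≤ e₀ := by exact_mod_cast hi_le.trans hγ
    have e2 : (m : ℝ) ≤ e₀ + 1 := by exact_mod_cast (by omega : m ≤ e₀ + 1)
    have e3 : (U.natK m : ℝ) ≤ 2 * (e₀ + 1) + c₁ := by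
      exact_mod_cast (by omega : U.natK m ≤ 2 * (e₀ + 1) + c₁)
    have e4 : (0 : ℝ) ≤ i := by positivity
    have e5 : (0 : ℝ) ≤ U.natK m := by positivity
    have e6 : (0 : ℝ) ≤ m := by positivity
    have e7 : (0 : ℝ) ≤ s := by positivity
    have e8 : (0 : ℝ) ≤ c₁ := by positivity
    have e9 : (0 : ℝ) ≤ c₃ := by positivity
    have e10 : (0 : ℝ) ≤ e₀ := by positivity
    push_cast
    constructor <;> linarith
  · rw [← hi] at hsum
    obtain ⟨p, hpl, hp⟩ := hU.exists_program (Nat.bits i) []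
    have hpi : p.length = U.natK i := hpl
    obtain ⟨q, hql, hq⟩ := hU.exists_program (Nat.bits e) []
    have hqe := h₁ e []
    have hloge : Nat.log 2 e ≤ e := Nat.log_le_self 2 e
    have a1 : U.natK m ≤ p.length + q.length + c₂ := h₂ p [] _ [] q _ _ hp (Part.mem_some _) hq (by
      rw [valLE_bits, valLE_bits, hpi, ← hsum]
      exact Part.mem_some _)
    have a2 : U.natK m ≤ U.natK i + s := by omega
    set t := m + s - i - U.natK m with ht
    obtain ⟨p', hpl', hp'⟩ := hU.exists_program (Nat.bits m) []
    have hpm : p'.length = U.natK m := hpl'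
    obtain ⟨q', hql', hq'⟩ := hU.exists_program (Nat.bits t) []
    have a3 : U.natK i ≤ p'.length + q'.length + c₃ :=
      h₃ p' [] _ [] q' _ _ hp' (Part.mem_some _) hq' (by
        rw [valLE_bits, valLE_bits, hpm]
        have : m + s - t - U.natK m = i := by omega
        rw [this]
        exact Part.mem_some _)
    have a4 := h₁ t []
    have a5 := four_mul_log_le t
    have a6 : t ≤ 8 + 2 * (c₁ + c₃ + e₀ + s) := by omega
    have b2 : (i : ℝ) + U.natK m + t = m + s := by
      exact_mod_cast (by omega : i + U.natK m + t = m + s)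
    have b3 : (t : ℝ) ≤ 8 + 2 * (c₁ + c₃ + e₀ + s) := by exact_mod_cast a6
    have e4 : (0 : ℝ) ≤ t := by positivity
    have e7 : (0 : ℝ) ≤ s := by positivity
    have e8 : (0 : ℝ) ≤ c₁ := by positivity
    have e10 : (0 : ℝ) ≤ e₀ := by positivity
    rw [abs_le]
    push_cast
    constructor <;> linarith

/-- The height of a drop. -/
theorem exists_abs_drop_sub_le (hU : U.IsUniversalPrefix) (c : ℕ) :
    ∃ C : ℝ, ∀ (x : List Bool) (Q : ℕ → ℝ), (∀ α, U.minLevel x ≤ α → 0 ≤ Q α) →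
      ∀ i : ℕ, 2 ≤ i → (i : ℕ∞) ≤ U.numModels Q x →
        |U.drop c Q x i - (Real.logb 2 (U.partialModel c Q x (i - 1)).card -
          Real.logb 2 (U.partialModel c Q x i).card -
          ((U.level Q x i - U.level Q x (i - 1) : ℕ) -
            U.natK (U.level Q x i - U.level Q x (i - 1))))| ≤ C := by
  obtain ⟨C, hC⟩ := hU.exists_abs_indexBits_sub_le c
  refine ⟨C + 1 + |1 - (U.natK 1 : ℝ)|, fun x Q hQ i hi hM => ?_⟩
  have hC0 : 0 ≤ C := (abs_nonneg _).trans (hC 0)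
  have hbits := level_add_structFun_le hQ hi hM
  obtain ⟨ha, hb, hab, hl⟩ := level_spec hi hM
  rw [drop, modStructFun, modStructFun, partialModel, partialModel]
  generalize U.level Q x i = b at *
  generalize U.level Q x (i - 1) = a at *
  obtain ⟨-, -, hx, -, hcl⟩ := hU.witness_spec hQ ha
  rw [ha.modelAt_eq, modelAt, hl]
  split_ifs with h
  · have hΔ : b - a = 1 := by omega
    rw [hΔ]
    have h2 : ∀ u v : ℝ, u - v - (u - v - (((1 : ℕ) : ℝ) - U.natK 1)) = 1 - U.natK 1 := by
      intro u v
      push_cast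
      ring
    rw [← h, h2]
    linarith
  · have hΔ : b - a = (b - 1 - a) + 1 := by omega
    rw [hΔ]
    generalize hγ : b - 1 - a = γ at *
    have h1 := hC γ
    have h2 : 2 ^ U.indexBits c γ ≤ (U.witness x a).card := by
      refine (Nat.pow_lt_of_lt_clog ?_).le
      have := U.indexBits_le c γ
      omega
    have h3 := abs_logb_card_indexModel_sub_le hx h2
    rw [abs_le] at h1 h3 ⊢
    have h4 := abs_nonneg (1 - (U.natK 1 : ℝ))
    constructor <;> linarith [h1.1, h1.2, h3.1, h3.2]

end IsUniversalPrefix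

end Machine

/-! ### Logarithmic bounds -/

theorem one_le_logb_of_two_le {n : ℕ} (hn : 2 ≤ n) : 1 ≤ Real.logb 2 (n : ℝ) := by
  rw [Real.le_logb_iff_rpow_le (by norm_num) (by positivity), Real.rpow_one]
  exact_mod_cast hn

theorem natLog_le_logb {n : ℕ} : (Nat.log 2 n : ℝ) ≤ Real.logb 2 (n : ℝ) := by
  exact_mod_cast Real.natLog_le_logb n 2

/-- The logarithm of a number that is at most linear in `n` is `O(log n)`. -/
theorem natLog_le_of_le_mul {n m : ℕ} {C : ℝ} (hn : 2 ≤ n) (hC : 1 ≤ C) (hm : (m : ℝ) ≤ C * n) :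
    (Nat.log 2 m : ℝ) ≤ (Real.logb 2 C + 1) * Real.logb 2 (n : ℝ) := by
  have h1 := one_le_logb_of_two_le hn
  have hn0 : (0 : ℝ) < n := by exact_mod_cast (by omega : 0 < n)
  have hC0 : 0 ≤ Real.logb 2 C := Real.logb_nonneg (by norm_num) hC
  rcases Nat.eq_zero_or_pos m with h | h
  · subst h
    simp only [Nat.log_zero_right, Nat.cast_zero]
    positivity
  · have h2 : Real.logb 2 (m : ℝ) ≤ Real.logb 2 (C * n) :=
      Real.logb_le_logb_of_le (by norm_num) (by exact_mod_cast h) hm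
    rw [Real.logb_mul (by linarith) hn0.ne'] at h2
    have h3 := natLog_le_logb (n := m)
    nlinarith

theorem logb_two_le {y : ℝ} (hy : 0 ≤ y) : Real.logb 2 y ≤ 2 * y := by
  have h2 : (1 : ℝ) / 2 < Real.log 2 := by linarith [Real.log_two_gt_d9]
  rcases hy.eq_or_lt with h | h
  · rw [← h]; simp
  · rw [Real.logb, div_le_iff₀ (by linarith)]
    have h3 := Real.log_le_sub_one_of_pos h
    nlinarith

theorem two_mul_log_le_half (m : ℕ) : 2 * (Nat.log 2 m : ℝ) ≤ m / 2 + 4 := by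
  have h : 4 * (Nat.log 2 m : ℝ) ≤ m + 8 := by exact_mod_cast four_mul_log_le m
  linarith

/-! ### Bounds on the drop levels -/

namespace Machine

variable {U : Machine}

namespace IsUniversalPrefix

/-- All drop levels are linear in the length of `x`; and beyond a level `β = O(log n)`, at which
the set of all strings of length `n` is available as a model, the log-size is at most `n`. -/
theorem exists_level_le (hU : U.IsUniversalPrefix) {Q : List Bool → ℕ → ℝ} {B : ℝ}
    (hB : ∀ (x : List Bool) (α : ℕ), U.minLevel x ≤ α →
      |Q x α - (U.condK (Nat.bits (U.structFun x α)) (Nat.bits α) : ℝ)| ≤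
        B * (1 + Real.logb 2 (Real.logb 2 (x.length : ℝ))))
    (hQ : ∀ (x : List Bool) (α : ℕ), U.minLevel x ≤ α → 0 ≤ Q x α) :
    ∃ (C : ℝ) (c : ℕ), 1 ≤ C ∧ ∀ x : List Bool, 2 ≤ x.length → ∀ a, U.IsDropLevel (Q x) x a →
      (a : ℝ) ≤ C * x.length ∧ (a ≤ 2 * Nat.log 2 x.length + c ∨
        U.structFun x a ≤ x.length) := by
  obtain ⟨c, hc⟩ := hU.exists_setK_cube_le
  obtain ⟨d, hd⟩ := hU.exists_condK_bits_le
  refine ⟨2 * (4 + d + |B| * 5 + 3 + c), c, ?_, fun x hn => ?_⟩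
  · have := abs_nonneg B
    have h1 : (0 : ℝ) ≤ c := by positivity
    have h2 : (0 : ℝ) ≤ d := by positivity
    linarith
  set n := x.length with hxn
  set β := 2 * Nat.log 2 n + c with hβ
  have hminβ : U.minLevel x ≤ β := minLevel_le (mem_cube_length x) (hc n)
  have hstruct : ∀ α, β ≤ α → U.structFun x α ≤ n := by
    intro α hα
    have h1 := structFun_le (mem_cube_length x) ((hc n).trans hα)
    rwa [card_cube, Nat.clog_pow _ _ (by norm_num)] at h1
  have hnr : (2 : ℝ) ≤ n := by exact_mod_cast hn
  have hlogn : (Nat.log 2 n : ℝ) ≤ n := by exact_mod_cast Nat.log_le_self 2 n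
  have hβr : (β : ℝ) = 2 * Nat.log 2 n + c := by rw [hβ]; push_cast; ring
  set W : ℝ := 2 * (4 + d + |B| * 5 + 3 + c) * n with hW
  have hBnn := abs_nonneg B
  have hBn : (0 : ℝ) ≤ |B| * n := by positivity
  have hcr : (0 : ℝ) ≤ c := by positivity
  have hdr : (0 : ℝ) ≤ d := by positivity
  have hcn : (c : ℝ) ≤ c * n := by nlinarith
  have hdn : (d : ℝ) ≤ d * n := by nlinarith
  have hWeq : W = 14 * n + 2 * (d * n) + 10 * (|B| * n) + 2 * (c * n) := by rw [hW]; ring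
  have hβW : (β : ℝ) + n ≤ W := by
    rw [hβr, hWeq]
    linarith
  have hloglog : B * (1 + Real.logb 2 (Real.logb 2 (n : ℝ))) ≤ 5 * (|B| * n) := by
    have h1 := one_le_logb_of_two_le hn
    have h2 : 0 ≤ Real.logb 2 (Real.logb 2 (n : ℝ)) := Real.logb_nonneg (by norm_num) h1
    have h3 := logb_two_le (y := Real.logb 2 (n : ℝ)) (by linarith)
    have h4 := logb_two_le (y := (n : ℝ)) (by linarith)
    have h5 : B * (1 + Real.logb 2 (Real.logb 2 (n : ℝ))) ≤
        |B| * (1 + Real.logb 2 (Real.logb 2 (n : ℝ))) :=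
      mul_le_mul_of_nonneg_right (le_abs_self B) (by linarith)
    have h6 : |B| * (1 + Real.logb 2 (Real.logb 2 (n : ℝ))) ≤ |B| * (5 * n) :=
      mul_le_mul_of_nonneg_left (by linarith) hBnn
    linarith
  have hpot : ∀ α, U.minLevel x ≤ α → U.lastDrop (Q x) x α ≤ β ∨
      (U.lastDrop (Q x) x α : ℝ) + U.structFun x (U.lastDrop (Q x) x α) ≤ W := by
    intro α hα
    induction α, hα using Nat.le_induction with
    | base => left; rwa [lastDrop_minLevel]
    | succ α hα ih =>
      rcases U.lastDrop_succ_cases (Q x) hα with ⟨h1, h2⟩ | ⟨h1, -⟩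
      · rw [h1]
        have hk1 := (U.lastDrop_bounds (Q x) hα).1
        have hQk := hQ x _ hk1
        rcases le_or_gt (α + 1) β with h3 | h3
        · exact Or.inl h3
        right
        rcases ih with h4 | h4
        · -- the level `α + 1` is the first drop level beyond `β`
          have hle : U.lastDrop (Q x) x β = U.lastDrop (Q x) x α := by
            refine le_antisymm ?_ ?_
            · exact IsDropLevel.le_lastDrop ⟨β, hminβ, rfl⟩
                ((U.lastDrop_bounds (Q x) hminβ).2.trans (by omega))
            · exact IsDropLevel.le_lastDrop ⟨α, hα, rfl⟩ h4
          set k := U.lastDrop (Q x) x α with hk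
          rcases h4.lt_or_eq with h5 | h5
          · have h6 := lt_of_lastDrop_lt (Q := Q x) hminβ (by rw [hle]; exact h5)
            rw [hle] at h6
            have h7 : (U.structFun x β : ℝ) ≤ n := by exact_mod_cast hstruct β le_rfl
            have h8 := (abs_le.1 (hB x k hk1)).2
            have h9 : (U.condK (Nat.bits (U.structFun x k)) (Nat.bits k) : ℝ) ≤
                2 * Nat.log 2 (U.structFun x k) + d := by exact_mod_cast hd _ _
            have h10 := two_mul_log_le_half (U.structFun x k)
            have h11 : (0 : ℝ) ≤ k := by positivity
            rw [← hxn] at h8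
            linarith
          · have h6 : (U.structFun x k : ℝ) ≤ n := by exact_mod_cast hstruct k h5.ge
            have h7 : (k : ℝ) = β := by exact_mod_cast h5
            linarith
        · linarith
      · rw [h1]
        exact ih
  intro a ha
  obtain ⟨ha1, ha2⟩ := isDropLevel_iff.1 ha
  refine ⟨?_, ?_⟩
  · rcases hpot a ha1 with h | h
    · rw [ha2] at h
      have : (a : ℝ) ≤ β := by exact_mod_cast h
      linarith
    · rw [ha2] at h
      have : (0 : ℝ) ≤ U.structFun x a := by positivity
      linarith
  · rcases le_or_gt a β with h | h
    · exact Or.inl h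
    · exact Or.inr (hstruct a h.le)

/-- The complexity of a drop level together with its log-size is `O(log n)`, even if the log-size
is not bounded in terms of `n`: in that case the level itself is `O(log n)`. -/
theorem exists_condK_level_le (hU : U.IsUniversalPrefix) {Q : List Bool → ℕ → ℝ} {B : ℝ}
    (hB : ∀ (x : List Bool) (α : ℕ), U.minLevel x ≤ α →
      |Q x α - (U.condK (Nat.bits (U.structFun x α)) (Nat.bits α) : ℝ)| ≤
        B * (1 + Real.logb 2 (Real.logb 2 (x.length : ℝ))))
    (hQ : ∀ (x : List Bool) (α : ℕ), U.minLevel x ≤ α → 0 ≤ Q x α) :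
    ∃ C : ℝ, ∀ x : List Bool, 2 ≤ x.length → ∀ a, U.IsDropLevel (Q x) x a →
      (U.condK (encPair a (Nat.clog 2 (U.witness x a).card)) (U.shortest x) : ℝ) ≤
        C * Real.logb 2 (x.length : ℝ) := by
  obtain ⟨C, c, hC, hlev⟩ := hU.exists_level_le hB hQ
  obtain ⟨c₁, h₁⟩ := hU.exists_condK_encPair_le
  obtain ⟨c₂, h₂⟩ := hU.exists_condK_witness_bounds
  obtain ⟨c₃, h₃⟩ := hU.exists_condK_le_K
  refine ⟨2 * (Real.logb 2 C + 1) + 2 + c + c₁ + c₂ + c₃, fun x hn a ha => ?_⟩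
  obtain ⟨ha1, ha2⟩ := hlev x hn a ha
  obtain ⟨-, -, -, hK, hcl⟩ := hU.witness_spec (hQ x) ha
  have hl := one_le_logb_of_two_le hn
  have hlogn := natLog_le_logb (n := x.length)
  have hloga := natLog_le_of_le_mul hn hC ha1
  have hC0 : 0 ≤ Real.logb 2 C := Real.logb_nonneg (by norm_num) hC
  set l := Real.logb 2 (x.length : ℝ) with hl'
  have e0 : (0 : ℝ) ≤ Real.logb 2 C * l := by positivity
  have e1 : (c : ℝ) ≤ c * l := le_mul_of_one_le_right (by positivity) hl
  have e2 : (c₁ : ℝ) ≤ c₁ * l := le_mul_of_one_le_right (by positivity) hl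
  have e3 : (c₂ : ℝ) ≤ c₂ * l := le_mul_of_one_le_right (by positivity) hl
  have e4 : (c₃ : ℝ) ≤ c₃ * l := le_mul_of_one_le_right (by positivity) hl
  have f1 : (0 : ℝ) ≤ c := by positivity
  have f2 : (0 : ℝ) ≤ c₁ := by positivity
  have f3 : (0 : ℝ) ≤ c₂ := by positivity
  have f4 : (0 : ℝ) ≤ c₃ := by positivity
  rcases ha2 with h | h
  · have g1 := (h₂ x (Q x) (hQ x) a ha).2
    have g2 := h₃ (encSet (U.witness x a)) (U.shortest x)
    have hK' : U.K (encSet (U.witness x a)) = a := hK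
    have g3 : (U.condK (encPair a (Nat.clog 2 (U.witness x a).card)) (U.shortest x) : ℝ) ≤
        2 * Nat.log 2 x.length + c + c₃ + c₂ := by
      exact_mod_cast (by omega : U.condK (encPair a (Nat.clog 2 (U.witness x a).card))
        (U.shortest x) ≤ 2 * Nat.log 2 x.length + c + c₃ + c₂)
    linarith
  · have g1 : (U.condK (encPair a (Nat.clog 2 (U.witness x a).card)) (U.shortest x) : ℝ) ≤
        2 * Nat.log 2 a + 2 * Nat.log 2 (Nat.clog 2 (U.witness x a).card) + c₁ := by
      exact_mod_cast h₁ _ _ _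
    have g2 : (Nat.log 2 (Nat.clog 2 (U.witness x a).card) : ℝ) ≤ Nat.log 2 x.length := by
      rw [hcl]
      exact_mod_cast Nat.log_mono_right h
    linarith

theorem exists_condK_bits_level_le (hU : U.IsUniversalPrefix) {Q : List Bool → ℕ → ℝ} {B : ℝ}
    (hB : ∀ (x : List Bool) (α : ℕ), U.minLevel x ≤ α →
      |Q x α - (U.condK (Nat.bits (U.structFun x α)) (Nat.bits α) : ℝ)| ≤
        B * (1 + Real.logb 2 (Real.logb 2 (x.length : ℝ))))
    (hQ : ∀ (x : List Bool) (α : ℕ), U.minLevel x ≤ α → 0 ≤ Q x α) :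
    ∃ C : ℝ, ∀ x : List Bool, 2 ≤ x.length → ∀ a, U.IsDropLevel (Q x) x a → ∀ m ≤ a, ∀ y,
      (U.condK (Nat.bits m) y : ℝ) ≤ C * Real.logb 2 (x.length : ℝ) := by
  obtain ⟨C, c, hC, hlev⟩ := hU.exists_level_le hB hQ
  obtain ⟨c₁, h₁⟩ := hU.exists_condK_bits_le
  refine ⟨2 * (Real.logb 2 C + 1) + c₁, fun x hn a ha m hm y => ?_⟩
  have hma : (m : ℝ) ≤ C * x.length :=
    le_trans (by exact_mod_cast hm) (hlev x hn a ha).1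
  have h2 := natLog_le_of_le_mul hn hC hma
  have h3 : (U.condK (Nat.bits m) y : ℝ) ≤ 2 * Nat.log 2 m + c₁ := by exact_mod_cast h₁ m y
  have h4 : (c₁ : ℝ) ≤ c₁ * Real.logb 2 (x.length : ℝ) :=
    le_mul_of_one_le_right (by positivity) (one_le_logb_of_two_le hn)
  linarith

/-- The two notions of deficiency of the witness at a drop level differ by `O(log n)`. -/
theorem exists_abs_deficiency_sub_le (hU : U.IsUniversalPrefix) {Q : List Bool → ℕ → ℝ} {B : ℝ}
    (hB : ∀ (x : List Bool) (α : ℕ), U.minLevel x ≤ α →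
      |Q x α - (U.condK (Nat.bits (U.structFun x α)) (Nat.bits α) : ℝ)| ≤
        B * (1 + Real.logb 2 (Real.logb 2 (x.length : ℝ))))
    (hQ : ∀ (x : List Bool) (α : ℕ), U.minLevel x ≤ α → 0 ≤ Q x α) :
    ∃ C : ℝ, ∀ x : List Bool, 2 ≤ x.length → ∀ a, U.IsDropLevel (Q x) x a →
      |U.deficiency x (U.witness x a) - U.strongDeficiency x (U.witness x a)| ≤
        C * Real.logb 2 (x.length : ℝ) := by
  obtain ⟨C, h₁⟩ := hU.exists_condK_bits_level_le hB hQ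
  obtain ⟨c₂, h₂⟩ := hU.exists_condK_le_condK_shortest
  obtain ⟨c₃, h₃⟩ := hU.exists_condK_shortest_le
  refine ⟨C + c₂ + c₃, fun x hn a ha => ?_⟩
  obtain ⟨-, -, -, hK, -⟩ := hU.witness_spec (hQ x) ha
  have hK' : U.K (encSet (U.witness x a)) = a := hK
  have hl := one_le_logb_of_two_le hn
  have g1 := h₁ x hn a ha a le_rfl (encSet (U.witness x a))
  have g2 : (U.condK x (encSet (U.witness x a)) : ℝ) ≤
      U.condK x (U.shortest (encSet (U.witness x a))) +
        U.condK (Nat.bits (U.K (encSet (U.witness x a)))) (encSet (U.witness x a)) + c₂ := by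
    exact_mod_cast h₂ x (encSet (U.witness x a))
  have g3 : (U.condK x (U.shortest (encSet (U.witness x a))) : ℝ) ≤
      U.condK x (encSet (U.witness x a)) + c₃ := by exact_mod_cast h₃ x (encSet (U.witness x a))
  rw [hK'] at g2
  have e2 : (c₂ : ℝ) ≤ c₂ * Real.logb 2 (x.length : ℝ) :=
    le_mul_of_one_le_right (by positivity) hl
  have e3 : (c₃ : ℝ) ≤ c₃ * Real.logb 2 (x.length : ℝ) :=
    le_mul_of_one_le_right (by positivity) hl
  have e4 : (0 : ℝ) ≤ U.condK (Nat.bits a) (encSet (U.witness x a)) := by positivity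
  have e5 : U.setShortest (U.witness x a) = U.shortest (encSet (U.witness x a)) := rfl
  rw [deficiency, strongDeficiency, e5, abs_le]
  have e6 : (0 : ℝ) ≤ c₂ := by positivity
  have e7 : (0 : ℝ) ≤ c₃ := by positivity
  constructor <;> linarith

end IsUniversalPrefix

end Machine

theorem mainTheorem2 (U : Machine) (hU : U.IsUniversalPrefix) (c : ℕ)
    (Q : List Bool → ℕ → ℝ)
    (hQ_nonneg : ∀ (x : List Bool) (α : ℕ), U.minLevel x ≤ α → 0 ≤ Q x α)
    (hQ : ∃ B : ℝ, ∀ (x : List Bool) (α : ℕ), U.minLevel x ≤ α →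
      |Q x α - (U.condK (Nat.bits (U.structFun x α)) (Nat.bits α) : ℝ)| ≤
        B * (1 + Real.logb 2 (Real.logb 2 (x.length : ℝ)))) :
    ∃ C : ℝ, ∀ (x : List Bool) (i : ℕ), 2 ≤ i → (i : ℕ∞) ≤ U.numModels (Q x) x →
      (2 ≤ x.length →
        |U.deficiency x (U.partialModel c (Q x) x (i - 1))
            - U.deficiency x (U.partialModel c (Q x) x i)
            - U.drop c (Q x) x i| ≤ C * Real.logb 2 (x.length : ℝ)) ∧
      |U.strongDeficiency x (U.partialModel c (Q x) x (i - 1))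
          - U.strongDeficiency x (U.partialModel c (Q x) x i)
          - (U.drop c (Q x) x i
              + ((U.advice c (Q x) x i : ℝ) - (U.advice c (Q x) x (i - 1) : ℝ)
                  - (U.natK (U.level (Q x) x i - U.level (Q x) x (i - 1)) : ℝ)))| ≤
        C * (1 + (logStar (U.level (Q x) x i - U.level (Q x) x (i - 1)) : ℝ)) ∧
      (2 ≤ x.length →
        |(U.advice c (Q x) x i : ℝ) - (U.advice c (Q x) x (i - 1) : ℝ)
            - (U.natK (U.level (Q x) x i - U.level (Q x) x (i - 1)) : ℝ)| ≤
          C * Real.logb 2 (x.length : ℝ)) := by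
  obtain ⟨B, hB⟩ := hQ
  obtain ⟨C₁, h₁⟩ := hU.exists_abs_strongDeficiency_sub_le
  obtain ⟨C₂, h₂⟩ := hU.exists_abs_drop_sub_le c
  obtain ⟨C₃, h₃⟩ := hU.exists_condK_level_le hB hQ_nonneg
  obtain ⟨C₄, h₄⟩ := hU.exists_condK_bits_level_le hB hQ_nonneg
  obtain ⟨C₅, h₅⟩ := hU.exists_abs_deficiency_sub_le hB hQ_nonneg
  -- the bound for `δ(x | S*)` comes first; the other two are derived with it
  refine ⟨(|C₁| + |C₁| + |C₂|) + (|C₃| + |C₃| + |C₄|) + (|C₅| + |C₅|), fun x i hi hM => ?_⟩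
  obtain ⟨ha, hb, hab, -⟩ := Machine.level_spec hi hM
  have k₁a := h₁ x (Q x) (hQ_nonneg x) _ ha
  have k₁b := h₁ x (Q x) (hQ_nonneg x) _ hb
  have k₂ := h₂ x (Q x) (hQ_nonneg x) i hi hM
  rw [Nat.cast_sub hab.le] at k₂
  have k₃a := fun hn => h₃ x hn _ ha
  have k₃b := fun hn => h₃ x hn _ hb
  have k₄ := fun hn => h₄ x hn _ hb _ (Nat.sub_le _ (U.level (Q x) x (i - 1))) []
  have k₅a := fun hn => h₅ x hn _ ha
  have k₅b := fun hn => h₅ x hn _ hb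
  have pa : U.partialModel c (Q x) x (i - 1) = U.witness x (U.level (Q x) x (i - 1)) :=
    ha.modelAt_eq
  have pb : U.partialModel c (Q x) x i = U.witness x (U.level (Q x) x i) := hb.modelAt_eq
  rw [Machine.advice, Machine.advice]
  rw [pa, pb] at k₂ ⊢
  have hnatK : U.natK (U.level (Q x) x i - U.level (Q x) x (i - 1)) =
    U.condK (Nat.bits (U.level (Q x) x i - U.level (Q x) x (i - 1))) [] := rfl
  rw [← hnatK] at k₄
  generalize U.natK (U.level (Q x) x i - U.level (Q x) x (i - 1)) = κ at *
  generalize U.condK (encPair (U.level (Q x) x i) _) _ = A at *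
  generalize U.condK (encPair (U.level (Q x) x (i - 1)) _) _ = A' at *
  have n1 := abs_nonneg C₁
  have n2 := abs_nonneg C₂
  have n3 := abs_nonneg C₃
  have n4 := abs_nonneg C₄
  have n5 := abs_nonneg C₅
  have m1 := le_abs_self C₁
  have m2 := le_abs_self C₂
  -- the levels and the log-sizes of both models cancel
  have hb' : |U.strongDeficiency x (U.witness x (U.level (Q x) x (i - 1)))
      - U.strongDeficiency x (U.witness x (U.level (Q x) x i))
      - (U.drop c (Q x) x i + ((A : ℝ) - (A' : ℝ) - (κ : ℝ)))| ≤ |C₁| + |C₁| + |C₂| := by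
    rw [abs_le] at k₁a k₁b k₂ ⊢
    constructor <;> linarith [k₁a.1, k₁a.2, k₁b.1, k₁b.2, k₂.1, k₂.2]
  have hc' : ∀ hn : 2 ≤ x.length, |(A : ℝ) - (A' : ℝ) - (κ : ℝ)| ≤
      (|C₃| + |C₃| + |C₄|) * Real.logb 2 (x.length : ℝ) := by
    intro hn
    have hl : 0 ≤ Real.logb 2 (x.length : ℝ) := zero_le_one.trans (one_le_logb_of_two_le hn)
    have t1 := (k₃a hn).trans (mul_le_mul_of_nonneg_right (le_abs_self C₃) hl)
    have t2 := (k₃b hn).trans (mul_le_mul_of_nonneg_right (le_abs_self C₃) hl)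
    have t3 := (k₄ hn).trans (mul_le_mul_of_nonneg_right (le_abs_self C₄) hl)
    have u1 : (0 : ℝ) ≤ A := by positivity
    have u2 : (0 : ℝ) ≤ A' := by positivity
    have u3 : (0 : ℝ) ≤ κ := by positivity
    rw [abs_le]
    constructor <;> linarith
  refine ⟨fun hn => ?_, ?_, fun hn => ?_⟩
  · have hl := one_le_logb_of_two_le hn
    have t1 := hc' hn
    have t2 := (k₅a hn).trans (mul_le_mul_of_nonneg_right (le_abs_self C₅) (by linarith))
    have t3 := (k₅b hn).trans (mul_le_mul_of_nonneg_right (le_abs_self C₅) (by linarith))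
    have t4 : |C₁| + |C₁| + |C₂| ≤ (|C₁| + |C₁| + |C₂|) * Real.logb 2 (x.length : ℝ) :=
      le_mul_of_one_le_right (by positivity) hl
    rw [abs_le] at t1 t2 t3 hb' ⊢
    constructor <;> linarith [t1.1, t1.2, t2.1, t2.2, t3.1, t3.2, hb'.1, hb'.2]
  · refine hb'.trans (le_trans ?_ (le_mul_of_one_le_right (by positivity) ?_))
    · linarith
    · have : (0 : ℝ) ≤ logStar (U.level (Q x) x i - U.level (Q x) x (i - 1)) := by positivity
      linarith
  · refine (hc' hn).trans (mul_le_mul_of_nonneg_right (by linarith) ?_)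
    exact zero_le_one.trans (one_le_logb_of_two_le hn)
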